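/- Let $N\ge 1$, $R>0$, $1\le p<\infty$, let $|\cdot|$ be any norm on $\mathbb{R}^N$, and let $f\colon\mathbb{R}^N\times\mathbb{R}^N\to\mathbb{R}^N$ be of class $C^1$. Let $\mathcal{W}^{1,p}=\mathcal{W}^{1,p}([-R,0],\mathbb{R}^N)$ be the space of absolutely continuous functions $\phi\colon[-R,0]\to\mathbb{R}^N$ whose almost everywhere derivative $\phi'$ belongs to $L^p$, with the norm $\|\phi\|=\bigl(|\phi(-R)|^p+\int_{-R}^0|\phi'(\theta)|^p\,d\theta\bigr)^{1/p}$. For every $(\phi,r)\in\mathcal{W}^{1,p}\times[0,R]$ the initial value problem $$\dot x(t)=f(x(t),x(t-r))\quad(t\ge 0),\qquad x(t)=\phi(t)\quad(t\in[-R,0])$$ has a unique maximal (non-extendable) solution $x(\cdot;\phi,r)\colon[-R,T_{\phi,r})\to\mathbb{R}^N$ with $0<T_{\phi,r}\le\infty$, and for all $0\le t<T_{\phi,r}$ the history $R_tx(\cdot;\phi,r)\colon[-R,0]\ni\theta\mapsto x(t+\theta;\phi,r)$ belongs to $\mathcal{W}^{1,p}$. Put $$\operatorname{dom}(\Phi)=\bigcup_{(\phi,r)\in\mathcal{W}^{1,p}\times[0,R]}[0,T_{\phi,r})\times\{(\phi,r)\},\qquad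 \Phi(t,\phi,r)=(R_tx(\cdot;\phi,r),r)\in\Omega:=\mathcal{W}^{1,p}\times[0,R].$$ Then $\Phi\colon\operatorname{dom}(\Phi)\to\Omega$ is a $C^1$-maximal semiflow in $\Omega\subset\mathcal{W}^{1,p}\times\mathbb{R}$ with escape time function $(\phi,r)\mapsto T_{\phi,r}$. That is: 1. $\Phi(0,u)=u$ for all $u\in\Omega$; and if $t,s\ge 0$, $(t,u)\in\operatorname{dom}(\Phi)$ and $(s,\Phi(t,u))\in\operatorname{dom}(\Phi)$, then $(t+s,u)\in\operatorname{dom}(\Phi)$ and $\Phi(t+s,u)=\Phi(s,\Phi(t,u))$. 2. $\Phi$ is continuous on $\operatorname{dom}(\Phi)$, and $(\phi,r)\mapsto T_{\phi,r}\in(0,\infty]$ is lower semicontinuous on $\Omega$. 3. Every point of $\Omega$ is a limit point of $\Omega$, and for each $t\ge 0$ the time-$t$ map $\Phi^t=\Phi(t,\cdot)$ is continuously Fréchet differentiable on $U_t=\{(\phi,r)\in\Omega: T_{\phi,r}>t\}$: every point of $U_t$ is a limit point of $U_t$; at each $u_0\in U_t$ there is a unique bounded linear operator $A=D\Phi^t(u_0)$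 of $\mathcal{W}^{1,p}\times\mathbb{R}$ into itself with $\|\Phi^t(u)-\Phi^t(u_0)-A(u-u_0)\|=o(\|u-u_0\|)$ as $u\to u_0$ in $U_t$; and $u\mapsto D\Phi^t(u)$ is continuous on $U_t$ in the operator norm. -/

import Mathlib

open Set Filter Topology MeasureTheory
open scoped NNReal ENNReal

noncomputable section

/-! ### Sobolev type spaces of functions on a compact interval -/

section Sobolev

variable {E : Type*} [NormedAddCommGroup E]

/-- Extension by `0` of a function on `[a, b]` to the real line. It is used only to speak about the
values and the derivative of the function inside `[a, b]`. -/
def zeroExtend {a b : ℝ} (φ : Icc a b → E) : ℝ → E := by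
  classical
  exact fun t => if h : t ∈ Icc a b then φ ⟨t, h⟩ else 0

theorem zeroExtend_of_mem {a b : ℝ} (φ : Icc a b → E) {t : ℝ} (h : t ∈ Icc a b) :
    zeroExtend φ t = φ ⟨t, h⟩ := by
  simp only [zeroExtend, dif_pos h]

theorem zeroExtend_add {a b : ℝ} (φ ψ : Icc a b → E) :
    zeroExtend (φ + ψ) = zeroExtend φ + zeroExtend ψ := by
  funext t
  by_cases h : t ∈ Icc a b <;> simp [zeroExtend, h]

theorem zeroExtend_zero {a b : ℝ} : zeroExtend (0 : Icc a b → E) = 0 := by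
  funext t
  by_cases h : t ∈ Icc a b <;> simp [zeroExtend, h]

variable [NormedSpace ℝ E]

theorem zeroExtend_smul {a b : ℝ} (c : ℝ) (φ : Icc a b → E) :
    zeroExtend (c • φ) = c • zeroExtend φ := by
  funext t
  by_cases h : t ∈ Icc a b <;> simp [zeroExtend, h]

variable [FiniteDimensional ℝ E]

theorem zeroExtend_ae_differentiableAt {a b : ℝ} {φ : Icc a b → E}
    (h : AbsolutelyContinuousOnInterval (zeroExtend φ) a b) :
    ∀ᵐ t ∂(volume.restrict (Icc a b)), DifferentiableAt ℝ (zeroExtend φ) t := by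
  rw [ae_restrict_iff' measurableSet_Icc]
  filter_upwards [h.boundedVariationOn.ae_differentiableAt_of_mem_uIcc] with t ht hmem
  exact ht (Icc_subset_uIcc hmem)

theorem deriv_zeroExtend_add {a b : ℝ} {φ ψ : Icc a b → E}
    (h : AbsolutelyContinuousOnInterval (zeroExtend φ) a b)
    (h' : AbsolutelyContinuousOnInterval (zeroExtend ψ) a b) :
    deriv (zeroExtend (φ + ψ)) =ᵐ[volume.restrict (Icc a b)]
      deriv (zeroExtend φ) + deriv (zeroExtend ψ) := by
  filter_upwards [zeroExtend_ae_differentiableAt h, zeroExtend_ae_differentiableAt h']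
    with t ht ht'
  rw [zeroExtend_add]
  exact deriv_add ht ht'

theorem deriv_zeroExtend_smul {a b : ℝ} (c : ℝ) {φ : Icc a b → E}
    (h : AbsolutelyContinuousOnInterval (zeroExtend φ) a b) :
    deriv (zeroExtend (c • φ)) =ᵐ[volume.restrict (Icc a b)] c • deriv (zeroExtend φ) := by
  filter_upwards [zeroExtend_ae_differentiableAt h] with t ht
  rw [zeroExtend_smul]
  exact deriv_const_smul c ht

variable (a b : ℝ) (p : ℝ≥0∞) (E)

/-- The linear space of the absolutely continuous functions `[a, b] → E` whose almost everywhere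
derivative belongs to `L^p([a, b], E)`. -/
def sobolevSubmodule : Submodule ℝ (Icc a b → E) where
  carrier := {φ | AbsolutelyContinuousOnInterval (zeroExtend φ) a b ∧
    MemLp (deriv (zeroExtend φ)) p (volume.restrict (Icc a b))}
  add_mem' := by
    rintro φ ψ ⟨h1, h2⟩ ⟨h3, h4⟩
    refine ⟨?_, (memLp_congr_ae (deriv_zeroExtend_add h1 h3)).2 (h2.add h4)⟩
    rw [zeroExtend_add]
    exact h1.add h3
  zero_mem' := by
    constructor
    · rw [zeroExtend_zero]
      exact (contDiff_const (c := (0 : E))).contDiffOn.absolutelyContinuousOnInterval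
    · rw [zeroExtend_zero]
      have : deriv (0 : ℝ → E) = 0 := by funext t; simp
      rw [this]
      exact MemLp.zero
  smul_mem' := by
    rintro c φ ⟨h1, h2⟩
    refine ⟨?_, (memLp_congr_ae (deriv_zeroExtend_smul c h1)).2 (h2.const_smul c)⟩
    rw [zeroExtend_smul]
    exact h1.const_smul c

/-- The space `𝒲^{1,p}([a, b], E)`. It is a type of its own so that it carries the Sobolev norm
below and not the topology of pointwise convergence. -/
def SobolevW : Type _ := ↥(sobolevSubmodule E a b p)

variable {a b p E}

instance : AddCommGroup (SobolevW E a b p) :=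
  inferInstanceAs (AddCommGroup ↥(sobolevSubmodule E a b p))

instance : Module ℝ (SobolevW E a b p) :=
  inferInstanceAs (Module ℝ ↥(sobolevSubmodule E a b p))

/-- The underlying function `[a, b] → E` of an element of the Sobolev type space. -/
def SobolevW.toFun (φ : SobolevW E a b p) : Icc a b → E :=
  (show ↥(sobolevSubmodule E a b p) from φ).1

theorem SobolevW.ext {φ ψ : SobolevW E a b p} (h : φ.toFun = ψ.toFun) : φ = ψ :=
  Subtype.ext h

/-- `φ t` is the value of `φ` at `t ∈ [a, b]`. -/
instance : CoeFun (SobolevW E a b p) (fun _ => ℝ → E) := ⟨fun φ => zeroExtend φ.toFun⟩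

theorem SobolevW.absolutelyContinuous (φ : SobolevW E a b p) :
    AbsolutelyContinuousOnInterval (⇑φ) a b :=
  (show ↥(sobolevSubmodule E a b p) from φ).2.1

theorem SobolevW.memLp_deriv (φ : SobolevW E a b p) :
    MemLp (deriv ⇑φ) p (volume.restrict (Icc a b)) :=
  (show ↥(sobolevSubmodule E a b p) from φ).2.2

variable [Fact (1 ≤ p)]

variable (E a b p) in
/-- The map `φ ↦ (φ(a), φ')` into the `ℓ^p`-product of `E` and `L^p([a, b], E)`. -/
def sobolevEmbedding :
    SobolevW E a b p →ₗ[ℝ] WithLp p (E × Lp E p (volume.restrict (Icc a b))) where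
  toFun φ := WithLp.toLp p (φ a, φ.memLp_deriv.toLp _)
  map_add' φ ψ := by
    have h1 : (⇑(φ + ψ) : ℝ → E) a = φ a + ψ a :=
      congrFun (zeroExtend_add φ.toFun ψ.toFun) a
    have h2 : (φ + ψ).memLp_deriv.toLp _ = φ.memLp_deriv.toLp _ + ψ.memLp_deriv.toLp _ := by
      rw [← MemLp.toLp_add]
      exact MemLp.toLp_congr _ _
        (deriv_zeroExtend_add φ.absolutelyContinuous ψ.absolutelyContinuous)
    rw [h1, h2]
    rfl
  map_smul' c φ := by
    have h1 : (⇑(c • φ) : ℝ → E) a = c • φ a := congrFun (zeroExtend_smul c φ.toFun) a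
    have h2 : (c • φ).memLp_deriv.toLp _ = c • φ.memLp_deriv.toLp _ := by
      rw [← MemLp.toLp_const_smul]
      exact MemLp.toLp_congr _ _ (deriv_zeroExtend_smul c φ.absolutelyContinuous)
    rw [h1, h2]
    rfl

theorem sobolevEmbedding_injective : Function.Injective (sobolevEmbedding E a b p) := by
  rw [injective_iff_map_eq_zero]
  intro φ hφ
  apply SobolevW.ext
  funext ⟨t, ht⟩
  have hab : a ≤ b := ht.1.trans ht.2
  have h0 := congrArg WithLp.ofLp hφ
  have h1 : (⇑φ : ℝ → E) a = 0 := congrArg Prod.fst h0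
  have h2 : φ.memLp_deriv.toLp _ = 0 := congrArg Prod.snd h0
  have h3 : deriv ⇑φ =ᵐ[volume.restrict (Icc a b)] 0 := by
    rw [← MemLp.toLp_eq_toLp_iff φ.memLp_deriv MemLp.zero, h2]
    exact (MemLp.toLp_zero _).symm
  have h4 : ∀ᵐ s, s ∈ uIcc a b → HasDerivAt (⇑φ) 0 s := by
    have h5 : ∀ᵐ s ∂(volume.restrict (Icc a b)), deriv (⇑φ) s = 0 ∧ DifferentiableAt ℝ (⇑φ) s := by
      filter_upwards [h3, zeroExtend_ae_differentiableAt φ.absolutelyContinuous] with s hs hs'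
      exact ⟨hs, hs'⟩
    rw [ae_restrict_iff' measurableSet_Icc] at h5
    filter_upwards [h5] with s hs hmem
    rw [uIcc_of_le hab] at hmem
    have h6 := (hs hmem).2.hasDerivAt
    rw [(hs hmem).1] at h6
    exact h6
  obtain ⟨C, hC⟩ := φ.absolutelyContinuous.const_of_ae_hasDerivAt_zero h4
  have h7 := hC a left_mem_uIcc
  have h8 := hC t (Icc_subset_uIcc ht)
  rw [zeroExtend_of_mem _ ht] at h8
  rw [h8, ← h7, h1]
  rfl

/-- The norm `‖φ‖ = (‖φ(a)‖ ^ p + ‖φ'‖_{L^p[a, b]} ^ p) ^ (1 / p)`. -/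
instance : NormedAddCommGroup (SobolevW E a b p) :=
  NormedAddCommGroup.induced _ _ (sobolevEmbedding E a b p) sobolevEmbedding_injective

instance : NormedSpace ℝ (SobolevW E a b p) :=
  NormedSpace.induced ℝ _ _ (sobolevEmbedding E a b p)

theorem SobolevW.norm_eq (hp : p ≠ ∞) (φ : SobolevW E a b p) :
    ‖φ‖ = (‖φ a‖ ^ p.toReal + ∫ t in Icc a b, ‖deriv ⇑φ t‖ ^ p.toReal) ^ (1 / p.toReal) := by
  have hp1 : (1 : ℝ≥0∞) ≤ p := Fact.out
  have hp0 : p ≠ 0 := (zero_lt_one.trans_le hp1).ne'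
  have hpr : 0 < p.toReal := ENNReal.toReal_pos hp0 hp
  have h1 : ‖φ‖ = ‖sobolevEmbedding E a b p φ‖ := rfl
  have h2 : ‖φ.memLp_deriv.toLp _‖ ^ p.toReal = ∫ t in Icc a b, ‖deriv ⇑φ t‖ ^ p.toReal := by
    rw [Lp.norm_toLp, φ.memLp_deriv.eLpNorm_eq_integral_rpow_norm hp0 hp,
      ENNReal.toReal_ofReal (by positivity), Real.rpow_inv_rpow _ hpr.ne']
    exact integral_nonneg fun t => by positivity
  rw [h1, WithLp.prod_norm_eq_add hpr, ← h2]
  rfl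

end Sobolev

/-! ### The delay differential equation -/

section Delay

variable {E : Type*} [NormedAddCommGroup E] [NormedSpace ℝ E]

/-- `x : [-R, T) → E`, with `0 < T ≤ ∞`, is a solution of the initial value problem
`x'(t) = f (x(t), x(t - r))` for `0 ≤ t < T` (a right derivative at `t = 0`), `x = φ` on `[-R, 0]`.
Only the values of `x` on `[-R, T)` and those of `φ` on `[-R, 0]` matter. -/
structure IsDelaySolution (f : E × E → E) (R r : ℝ) (φ : ℝ → E) (T : ℝ≥0∞) (x : ℝ → E) :
    Prop where
  pos : 0 < T
  initial : ∀ θ ∈ Icc (-R) 0, x θ = φ θ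
  hasDeriv : ∀ t : ℝ, 0 ≤ t → ENNReal.ofReal t < T →
    HasDerivWithinAt x (f (x t, x (t - r))) (Ici 0) t

/-- `x` and `y` agree on `[-R, T)`. -/
def AgreeBefore (R : ℝ) (T : ℝ≥0∞) (x y : ℝ → E) : Prop :=
  ∀ t : ℝ, -R ≤ t → ENNReal.ofReal t < T → x t = y t

/-- `x : [-R, T) → E` is a solution without a proper extension to a solution. -/
structure IsMaximalDelaySolution (f : E × E → E) (R r : ℝ) (φ : ℝ → E) (T : ℝ≥0∞) (x : ℝ → E) :
    Prop where
  isSolution : IsDelaySolution f R r φ T x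
  maximal : ∀ (T' : ℝ≥0∞) (x' : ℝ → E), IsDelaySolution f R r φ T' x' → T ≤ T' →
    AgreeBefore R T x' x → T' = T

/-- The maximal solution together with its maximal existence time. -/
def maximalDelaySolution (f : E × E → E) (R r : ℝ) (φ : ℝ → E) : ℝ≥0∞ × (ℝ → E) :=
  Classical.epsilon fun q => IsMaximalDelaySolution f R r φ q.1 q.2

/-- The maximal existence time `T_{φ,r}`. -/
def delayEscapeTime (f : E × E → E) (R r : ℝ) (φ : ℝ → E) : ℝ≥0∞ :=
  (maximalDelaySolution f R r φ).1

/-- The maximal solution `x(·; φ, r) : [-R, T_{φ,r}) → E`. -/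
def delaySolution (f : E × E → E) (R r : ℝ) (φ : ℝ → E) : ℝ → E :=
  (maximalDelaySolution f R r φ).2

/-- The history `R_t x : [-R, 0] → E`, `θ ↦ x (t + θ)`. -/
def history (R : ℝ) (x : ℝ → E) (t : ℝ) : Icc (-R) 0 → E := fun θ => x (t + θ)

variable [FiniteDimensional ℝ E]

/-- The history `R_t x` as an element of `𝒲^{1,p}([-R, 0], E)`
(with the value `0` if it does not belong to this space). -/
def sobolevHistory (R : ℝ) (p : ℝ≥0∞) (x : ℝ → E) (t : ℝ) : SobolevW E (-R) 0 p := by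
  classical
  exact if h : history R x t ∈ sobolevSubmodule E (-R) 0 p then
    (show SobolevW E (-R) 0 p from ⟨history R x t, h⟩) else 0

/-- `Φ(t, φ, r) = (R_t x(·; φ, r), r)`. -/
def delaySemiflow (f : E × E → E) (R : ℝ) (p : ℝ≥0∞) (t : ℝ≥0) (q : SobolevW E (-R) 0 p × ℝ) :
    SobolevW E (-R) 0 p × ℝ :=
  (sobolevHistory R p (delaySolution f R q.2 q.1) t, q.2)

end Delay

/-! ### Maximal semiflows -/

section Semiflow

/-- The set `⋃_{x ∈ Ω} [0, T(x)) × {x}`. -/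
def semiflowDomain {X : Type*} (Ω : Set X) (T : X → ℝ≥0∞) : Set (ℝ≥0 × X) :=
  {q | q.2 ∈ Ω ∧ (q.1 : ℝ≥0∞) < T q.2}

/-- `Φ`, restricted to `⋃_{x ∈ Ω} [0, T(x)) × {x}`, is a maximal semiflow in the set `Ω` with the
escape time function `T : Ω → (0, ∞]`. Values of `Φ` and `T` elsewhere do not matter. -/
structure IsMaximalSemiflow {X : Type*} (Ω : Set X) (Φ : ℝ≥0 → X → X) (T : X → ℝ≥0∞) :
    Prop where
  escapeTime_pos : ∀ x ∈ Ω, 0 < T x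
  mapsTo : ∀ t x, (t, x) ∈ semiflowDomain Ω T → Φ t x ∈ Ω
  map_zero : ∀ x ∈ Ω, Φ 0 x = x
  map_add : ∀ t s x, (t, x) ∈ semiflowDomain Ω T → (s, Φ t x) ∈ semiflowDomain Ω T →
    (t + s, x) ∈ semiflowDomain Ω T ∧ Φ (t + s) x = Φ s (Φ t x)

/-- A maximal semiflow which is continuous and has a lower semicontinuous escape time. -/
structure IsC0MaximalSemiflow {X : Type*} [TopologicalSpace X] (Ω : Set X) (Φ : ℝ≥0 → X → X)
    (T : X → ℝ≥0∞) : Prop extends IsMaximalSemiflow Ω Φ T where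
  continuousOn : ContinuousOn (fun q : ℝ≥0 × X => Φ q.1 q.2) (semiflowDomain Ω T)
  lowerSemicontinuousOn : LowerSemicontinuousOn T Ω

variable {X Y : Type*} [NormedAddCommGroup X] [NormedSpace ℝ X]
  [NormedAddCommGroup Y] [NormedSpace ℝ Y]

/-- `g` is continuously Fréchet differentiable on a set `U`, not necessarily open: `U` consists of
limit points of `U`, at each point of `U` there is a unique bounded linear approximation of `g`
along `U`, and it depends continuously on the point in the operator norm. -/
def ContinuouslyFrechetDifferentiableOn (g : X → Y) (U : Set X) : Prop :=
  (∀ x ∈ U, AccPt x (𝓟 U)) ∧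
  ∃ g' : X → X →L[ℝ] Y,
    (∀ x ∈ U, HasFDerivWithinAt g (g' x) U x ∧
      ∀ A : X →L[ℝ] Y, HasFDerivWithinAt g A U x → A = g' x) ∧
    ContinuousOn g' U

/-- A `C^0`-maximal semiflow in a subset `Ω` of a normed space, consisting of limit points of `Ω`,
all of whose time-`t` maps are continuously Fréchet differentiable. -/
structure IsC1MaximalSemiflow (Ω : Set X) (Φ : ℝ≥0 → X → X) (T : X → ℝ≥0∞) : Prop
    extends IsC0MaximalSemiflow Ω Φ T where
  accPt : ∀ x ∈ Ω, AccPt x (𝓟 Ω)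
  contFrechet : ∀ t : ℝ≥0,
    ContinuouslyFrechetDifferentiableOn (Φ t) {x | x ∈ Ω ∧ (t : ℝ≥0∞) < T x}

end Semiflow

end

/-!
The delay equation is rewritten as an equation for the derivative of the solution in `L^p`, to which
the implicit function theorem applies.

Write a trajectory as `x(t) = c + ∫_{-R}^t g` (`traj`) with `c ∈ E` and `g ∈ L^p(ℝ)`. An initial
function `φ` corresponds to `c = φ(-R)` and `g = φ'` on `[-R, 0]` (`SobolevW.toPair`), and a
solution on `[0, T]` is obtained by adding to `g` some `v ∈ L^p(ℝ)`, carried by `[0, T]`, such that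
`v(s) = f(x(s), x(s - r))` for `0 ≤ s ≤ T` (`SolvesDeriv`). In this form the delay may be any real
number, so that the parameters `(r, c, g)` range over a whole Banach space and the end points of
`[0, R]` are not special.

The right-hand side is a `C^1` function of `(r, c, g + v)` with values in `L^p`, although
`x ∈ W^{1,p}` is only absolutely continuous. Indeed, the restriction of `x(· - r)` to `[0, T]` is
differentiable in `r` as an element of `L^p`, with derivative `-g(· - r)`: its increments are
`L^p`-valued integrals of translates of `g` (`delayedLp_sub`), and translations are strongly
continuous in `L^p` for `p < ∞`. The increments of the substitution operator are the increments of
its `L^p`-valued argument, multiplied by the averaged derivative of `f`, which is uniformly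
continuous in the trajectory (`delayRhs_sub`, `hasFDerivAt_of_sub_eq_apply`); hence the substitution
operator is `C^1` as well (`contDiff_delayRhs`).

The linearization in `v` is `1` minus a Volterra operator with a delay in `[0, R]`. The powers of the
Volterra operator decay factorially, so that the linearization is invertible
(`isUnit_one_sub_volterra`). The same fact, applied to averaged derivatives, shows that solutions are
unique (`SolvesDeriv.unique`). The implicit function theorem (`SolvesDeriv.exists_contDiffAt`) thus
extends a given solution on `[0, T]` to solutions on the same interval for all nearby data, with a
`C^1` dependence of `(c, g + v)` on the data. Lower semicontinuity of the escape time, continuity of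
the semiflow and differentiability of the time-`t` maps follow at once
(`exists_contDiffAt_trajectory`), because the history at time `t` is given by `x(t - R)` and the
translate of `g + v` by `t` (`window`).

Local solutions come from the Picard-Lindelöf theorem, with the delayed state as a known function of
time if `r > 0`. Maximal solutions are unions of solutions, and the semigroup property is obtained by
gluing solutions (`IsDelaySolution.glue`).
-/

noncomputable section

/-! ### Primitives and translations of `L^p` functions -/

section Primitive

variable {E : Type*} [NormedAddCommGroup E] [NormedSpace ℝ E] {p : ℝ≥0∞} [Fact (1 ≤ p)]

omit [NormedSpace ℝ E] in
theorem Lp.integrableOn_of_measure_lt_top (g : Lp E p (volume : Measure ℝ)) {s : Set ℝ}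
    (hs : volume s < ∞) : IntegrableOn g s := by
  have : IsFiniteMeasure (volume.restrict s) := ⟨by simpa using hs⟩
  exact ((Lp.memLp g).restrict s).integrable Fact.out

omit [NormedSpace ℝ E] in
theorem Lp.intervalIntegrable (g : Lp E p (volume : Measure ℝ)) (a b : ℝ) :
    IntervalIntegrable g volume a b :=
  ⟨Lp.integrableOn_of_measure_lt_top g measure_Ioc_lt_top,
    Lp.integrableOn_of_measure_lt_top g measure_Ioc_lt_top⟩

omit [NormedSpace ℝ E] in
theorem Lp.setIntegral_norm_le (g : Lp E p (volume : Measure ℝ)) {s : Set ℝ}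
    (hs : volume s < ∞) : ∫ t in s, ‖g t‖ ≤ (1 + (volume s).toReal) * ‖g‖ := by
  have hp1 : (1 : ℝ≥0∞) ≤ p := Fact.out
  rw [integral_norm_eq_lintegral_enorm (Lp.aestronglyMeasurable g).restrict,
    ← eLpNorm_one_eq_lintegral_enorm]
  have h1 := eLpNorm_le_eLpNorm_mul_rpow_measure_univ hp1
    ((Lp.aestronglyMeasurable g).restrict (s := s))
  have h2 : eLpNorm g p (volume.restrict s) ≤ eLpNorm g p volume :=
    eLpNorm_mono_measure _ Measure.restrict_le_self
  have h3 : (volume.restrict s) univ ^ (1 / (1 : ℝ≥0∞).toReal - 1 / p.toReal) ≤ 1 + volume s := by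
    rw [Measure.restrict_apply_univ, ENNReal.toReal_one, div_one]
    have h0 : 0 ≤ 1 - 1 / p.toReal := by
      rcases eq_or_ne p ∞ with rfl | hp
      · simp
      · have h5 : 1 ≤ p.toReal := by
          have := ENNReal.toReal_mono hp hp1
          simpa using this
        have : 1 / p.toReal ≤ 1 := by
          rw [div_le_one (by linarith)]; exact h5
        linarith
    calc (volume s) ^ (1 - 1 / p.toReal) ≤ (1 + volume s) ^ (1 - 1 / p.toReal) :=
          ENNReal.rpow_le_rpow le_add_self h0
      _ ≤ (1 + volume s) ^ (1 : ℝ) := by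
          apply ENNReal.rpow_le_rpow_of_exponent_le le_self_add
          have : 0 ≤ 1 / p.toReal := by positivity
          linarith
      _ = 1 + volume s := ENNReal.rpow_one _
  have h4 : eLpNorm g 1 (volume.restrict s) ≤ (1 + volume s) * eLpNorm g p volume := by
    rw [mul_comm]
    exact h1.trans (mul_le_mul' h2 h3)
  have h5 := ENNReal.toReal_mono
    (ENNReal.mul_ne_top (by simpa using hs.ne) (Lp.memLp g).eLpNorm_ne_top) h4
  rw [ENNReal.toReal_mul, ENNReal.toReal_add (by simp) hs.ne, ENNReal.toReal_one] at h5
  rwa [Lp.norm_def]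

omit [NormedSpace ℝ E] in
theorem Lp.integral_norm_le (g : Lp E p (volume : Measure ℝ)) {a b : ℝ} (hab : a ≤ b) :
    ∫ t in a..b, ‖g t‖ ≤ (1 + (b - a)) * ‖g‖ := by
  rw [intervalIntegral.integral_of_le hab]
  have := Lp.setIntegral_norm_le g (s := Ioc a b) measure_Ioc_lt_top
  rwa [Real.volume_Ioc, ENNReal.toReal_ofReal (by linarith)] at this

theorem Lp.norm_integral_le (g : Lp E p (volume : Measure ℝ)) (a b : ℝ) :
    ‖∫ t in a..b, g t‖ ≤ (1 + |b - a|) * ‖g‖ := by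
  rcases le_total a b with h | h
  · rw [abs_of_nonneg (by linarith)]
    exact (intervalIntegral.norm_integral_le_integral_norm h).trans (Lp.integral_norm_le g h)
  · rw [intervalIntegral.integral_symm, norm_neg, abs_of_nonpos (by linarith), neg_sub]
    exact (intervalIntegral.norm_integral_le_integral_norm h).trans (Lp.integral_norm_le g h)

theorem Lp.integral_add_apply (g h : Lp E p (volume : Measure ℝ)) (a b : ℝ) :
    ∫ t in a..b, (g + h : Lp E p volume) t = (∫ t in a..b, g t) + ∫ t in a..b, h t := by
  rw [← intervalIntegral.integral_add (Lp.intervalIntegrable g a b) (Lp.intervalIntegrable h a b)]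
  refine intervalIntegral.integral_congr_ae ?_
  filter_upwards [Lp.coeFn_add g h] with t ht _ using ht

omit [Fact (1 ≤ p)] in
theorem Lp.integral_smul_apply (c : ℝ) (g : Lp E p (volume : Measure ℝ)) (a b : ℝ) :
    ∫ t in a..b, (c • g : Lp E p volume) t = c • ∫ t in a..b, g t := by
  rw [← intervalIntegral.integral_smul]
  refine intervalIntegral.integral_congr_ae ?_
  filter_upwards [Lp.coeFn_smul c g] with t ht _ using ht

theorem Lp.continuous_primitive (g : Lp E p (volume : Measure ℝ)) (a : ℝ) :
    Continuous fun t => ∫ s in a..t, g s :=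
  intervalIntegral.continuous_primitive (fun _ _ => Lp.intervalIntegrable g _ _) a

/-- The function `t ↦ c + ∫_{-R}^t g` with value `c` at `-R` and derivative `g`, for
`z = (c, g)`. -/
def traj (R : ℝ) (z : E × Lp E p (volume : Measure ℝ)) (t : ℝ) : E :=
  z.1 + ∫ s in (-R)..t, z.2 s

theorem traj_add (R : ℝ) (z w : E × Lp E p (volume : Measure ℝ)) (t : ℝ) :
    traj R (z + w) t = traj R z t + traj R w t := by
  simp only [traj, Prod.fst_add, Prod.snd_add, Lp.integral_add_apply]
  abel

omit [Fact (1 ≤ p)] in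
theorem traj_smul (R : ℝ) (c : ℝ) (z : E × Lp E p (volume : Measure ℝ)) (t : ℝ) :
    traj R (c • z) t = c • traj R z t := by
  simp only [traj, Prod.smul_fst, Prod.smul_snd, Lp.integral_smul_apply, smul_add]

theorem traj_sub (R : ℝ) (z w : E × Lp E p (volume : Measure ℝ)) (t : ℝ) :
    traj R (z - w) t = traj R z t - traj R w t := by
  have := traj_add R (z - w) w t
  rw [sub_add_cancel] at this
  rw [this, add_sub_cancel_right]

theorem continuous_traj (R : ℝ) (z : E × Lp E p (volume : Measure ℝ)) :
    Continuous (traj R z) :=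
  continuous_const.add (Lp.continuous_primitive z.2 _)

theorem norm_traj_le (R : ℝ) (z : E × Lp E p (volume : Measure ℝ)) (t : ℝ) :
    ‖traj R z t‖ ≤ (2 + |t + R|) * ‖z‖ := by
  have h1 := Lp.norm_integral_le z.2 (-R) t
  rw [sub_neg_eq_add] at h1
  have h2 : ‖z.1‖ ≤ ‖z‖ := norm_fst_le z
  have h3 : ‖z.2‖ ≤ ‖z‖ := norm_snd_le z
  have h4 : (1 + |t + R|) * ‖z.2‖ ≤ (1 + |t + R|) * ‖z‖ := by gcongr
  have h5 := norm_add_le z.1 (∫ s in (-R)..t, z.2 s)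
  unfold traj
  linarith

theorem continuous_traj_uncurry (R : ℝ) :
    Continuous fun q : (E × Lp E p (volume : Measure ℝ)) × ℝ => traj R q.1 q.2 := by
  rw [continuous_iff_continuousAt]
  rintro ⟨z₀, t₀⟩
  have h1 : Tendsto (fun q : (E × Lp E p (volume : Measure ℝ)) × ℝ =>
      (2 + |q.2 + R|) * ‖q.1 - z₀‖) (𝓝 (z₀, t₀)) (𝓝 0) := by
    have : Continuous fun q : (E × Lp E p (volume : Measure ℝ)) × ℝ =>
      (2 + |q.2 + R|) * ‖q.1 - z₀‖ := by fun_prop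
    simpa using this.tendsto (z₀, t₀)
  have h2 : Tendsto (fun q : (E × Lp E p (volume : Measure ℝ)) × ℝ => traj R (q.1 - z₀) q.2)
      (𝓝 (z₀, t₀)) (𝓝 0) :=
    squeeze_zero_norm (fun q => norm_traj_le R (q.1 - z₀) q.2) h1
  have h3 : Tendsto (fun q : (E × Lp E p (volume : Measure ℝ)) × ℝ => traj R z₀ q.2)
      (𝓝 (z₀, t₀)) (𝓝 (traj R z₀ t₀)) :=
    ((continuous_traj R z₀).comp continuous_snd).tendsto (z₀, t₀)
  have h4 := h2.add h3
  rw [zero_add] at h4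
  refine h4.congr fun q => ?_
  rw [traj_sub, sub_add_cancel]

variable (E p) in
/-- Translation `g ↦ g(· - r)`, an isometry of `L^p(ℝ)`. -/
def shift (r : ℝ) : Lp E p (volume : Measure ℝ) →ₗᵢ[ℝ] Lp E p (volume : Measure ℝ) :=
  Lp.compMeasurePreservingₗᵢ ℝ (fun s => s - r) (measurePreserving_sub_right volume r)

theorem shift_ae (r : ℝ) (g : Lp E p (volume : Measure ℝ)) :
    shift E p r g =ᵐ[volume] fun s => g (s - r) :=
  Lp.coeFn_compMeasurePreserving g (measurePreserving_sub_right volume r)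

theorem continuous_shift (hp : p ≠ ∞) :
    Continuous fun q : ℝ × Lp E p (volume : Measure ℝ) => shift E p q.1 q.2 := by
  let τ : ℝ × Lp E p (volume : Measure ℝ) → C(ℝ, ℝ) := fun q => ⟨fun s => s - q.1, by fun_prop⟩
  have hτ : Continuous τ :=
    ContinuousMap.continuous_of_continuous_uncurry _
      (by simp only [τ, Function.uncurry_def, ContinuousMap.coe_mk]; fun_prop)
  exact continuous_snd.compMeasurePreservingLp hτ
    (fun q => measurePreserving_sub_right volume q.1) hp

theorem integral_shift (r : ℝ) (g : Lp E p (volume : Measure ℝ)) (a b : ℝ) :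
    ∫ s in a..b, shift E p r g s = ∫ s in (a - r)..(b - r), g s := by
  rw [← intervalIntegral.integral_comp_sub_right (fun s => g s)]
  refine intervalIntegral.integral_congr_ae ?_
  filter_upwards [shift_ae r g] with s hs _ using hs

variable (p) in
/-- Integration over a set of finite measure, as a continuous linear map on `L^p(ℝ)`. -/
def setIntegralCLM (s : Set ℝ) (hs : volume s < ∞) : Lp E p (volume : Measure ℝ) →L[ℝ] E :=
  LinearMap.mkContinuous
    { toFun := fun g => ∫ t in s, g t
      map_add' := fun g h => by
        rw [← integral_add (Lp.integrableOn_of_measure_lt_top g hs)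
          (Lp.integrableOn_of_measure_lt_top h hs)]
        refine integral_congr_ae (ae_restrict_of_ae ?_)
        filter_upwards [Lp.coeFn_add g h] with t ht using ht
      map_smul' := fun c g => by
        rw [RingHom.id_apply, ← integral_smul]
        refine integral_congr_ae (ae_restrict_of_ae ?_)
        filter_upwards [Lp.coeFn_smul c g] with t ht using ht }
    (1 + (volume s).toReal)
    (fun g => (norm_integral_le_integral_norm _).trans (Lp.setIntegral_norm_le g hs))

theorem setIntegralCLM_apply (s : Set ℝ) (hs : volume s < ∞) (g : Lp E p (volume : Measure ℝ)) :
    setIntegralCLM p s hs g = ∫ t in s, g t := rfl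

end Primitive

/-! ### Continuous functions on `[0, T]` in `L^q(ℝ)`, and multiplication operators -/

section Cutoff

variable {E F G : Type*} [NormedAddCommGroup E] [NormedSpace ℝ E]
  [NormedAddCommGroup F] [NormedSpace ℝ F] [NormedAddCommGroup G] [NormedSpace ℝ G]
  {T : ℝ} {p q : ℝ≥0∞} [Fact (1 ≤ p)] [Fact (1 ≤ q)]

omit [NormedSpace ℝ F] in
theorem zeroExtend_of_notMem {a b : ℝ} (φ : Icc a b → F) {t : ℝ} (h : t ∉ Icc a b) :
    zeroExtend φ t = 0 := by
  simp only [zeroExtend, dif_neg h]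

omit [NormedSpace ℝ F] in
theorem indicator_zeroExtend {a b : ℝ} (φ : Icc a b → F) :
    (Icc a b).indicator (zeroExtend φ) = zeroExtend φ :=
  indicator_eq_self.2 fun t ht => by
    by_contra h
    exact ht (zeroExtend_of_notMem φ h)

omit [NormedSpace ℝ F] in
theorem continuousOn_zeroExtend {a b : ℝ} (φ : C(Icc a b, F)) :
    ContinuousOn (zeroExtend φ) (Icc a b) := by
  rw [continuousOn_iff_continuous_domRestrict]
  convert φ.continuous using 1
  funext t
  exact zeroExtend_of_mem _ t.2

omit [NormedSpace ℝ F] in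
theorem norm_zeroExtend_le (a : C(Icc 0 T, F)) (s : ℝ) :
    ‖zeroExtend a s‖ ≤ (Icc 0 T).indicator (fun _ => ‖a‖) s := by
  by_cases h : s ∈ Icc 0 T
  · rw [zeroExtend_of_mem _ h, indicator_of_mem h]
    exact a.norm_coe_le_norm _
  · rw [zeroExtend_of_notMem _ h, indicator_of_notMem h, norm_zero]

omit [NormedSpace ℝ F] in
theorem aestronglyMeasurable_zeroExtend (a : C(Icc 0 T, F)) :
    AEStronglyMeasurable (zeroExtend a) (volume : Measure ℝ) := by
  rw [← indicator_zeroExtend, aestronglyMeasurable_indicator_iff measurableSet_Icc]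
  exact (continuousOn_zeroExtend a).aestronglyMeasurable measurableSet_Icc

variable (T q) in
/-- The norm of the indicator function of `[0, T]` in `L^q(ℝ)`. -/
def cutConst : ℝ := ((volume (Icc 0 T)) ^ q.toReal⁻¹).toReal

omit [Fact (1 ≤ q)] in
theorem cutConst_nonneg : 0 ≤ cutConst T q := ENNReal.toReal_nonneg

omit [NormedSpace ℝ F] [Fact (1 ≤ q)] in
theorem eLpNorm_le_of_le_indicator {h : ℝ → F} {c : ℝ} (hc : 0 ≤ c)
    (hh : ∀ᵐ s, ‖h s‖ ≤ (Icc 0 T).indicator (fun _ => c) s) :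
    eLpNorm h q volume ≤ ENNReal.ofReal (cutConst T q * c) := by
  have h1 : eLpNorm h q volume ≤ eLpNorm ((Icc 0 T).indicator (fun _ : ℝ => c)) q volume :=
    eLpNorm_mono_ae_real hh
  rw [eLpNorm_indicator_eq_eLpNorm_restrict measurableSet_Icc] at h1
  have h2 := eLpNorm_le_of_ae_bound (p := q) (μ := volume.restrict (Icc 0 T))
    (f := fun _ : ℝ => c) (C := c) (Eventually.of_forall fun _ => by
      rw [Real.norm_of_nonneg hc])
  refine (h1.trans h2).trans_eq ?_
  rw [ENNReal.ofReal_mul cutConst_nonneg, cutConst, ENNReal.ofReal_toReal,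
    Measure.restrict_apply_univ]
  exact ENNReal.rpow_ne_top_of_nonneg (by positivity) (by simp)

omit [NormedSpace ℝ F] [Fact (1 ≤ q)] in
theorem Lp.norm_le_of_le_indicator (h : Lp F q (volume : Measure ℝ)) {c : ℝ} (hc : 0 ≤ c)
    (hh : ∀ᵐ s, ‖h s‖ ≤ (Icc 0 T).indicator (fun _ => c) s) :
    ‖h‖ ≤ cutConst T q * c := by
  rw [Lp.norm_def]
  exact ENNReal.toReal_le_of_le_ofReal (mul_nonneg cutConst_nonneg hc)
    (eLpNorm_le_of_le_indicator hc hh)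

omit [NormedSpace ℝ F] [Fact (1 ≤ q)] in
theorem memLp_zeroExtend (a : C(Icc 0 T, F)) : MemLp (zeroExtend a) q (volume : Measure ℝ) :=
  ⟨aestronglyMeasurable_zeroExtend a, (eLpNorm_le_of_le_indicator (norm_nonneg a)
    (Eventually.of_forall (norm_zeroExtend_le a))).trans_lt ENNReal.ofReal_lt_top⟩

variable (F T q) in
/-- A continuous function on `[0, T]`, extended by `0`, as an element of `L^q(ℝ)`. -/
def cutLp : C(Icc 0 T, F) →L[ℝ] Lp F q (volume : Measure ℝ) :=
  LinearMap.mkContinuous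
    { toFun := fun a => (memLp_zeroExtend a).toLp _
      map_add' := fun a b => by
        rw [← MemLp.toLp_add]
        exact MemLp.toLp_congr _ _ (Eventually.of_forall fun s =>
          congrFun (zeroExtend_add a b) s)
      map_smul' := fun c a => by
        rw [RingHom.id_apply, ← MemLp.toLp_const_smul]
        exact MemLp.toLp_congr _ _ (Eventually.of_forall fun s =>
          congrFun (zeroExtend_smul c a) s) }
    (cutConst T q)
    (fun a => Lp.norm_le_of_le_indicator _ (norm_nonneg a) (by
      filter_upwards [(memLp_zeroExtend (q := q) a).coeFn_toLp] with s hs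
      exact hs ▸ norm_zeroExtend_le a s))

theorem cutLp_ae (a : C(Icc 0 T, F)) : cutLp F T q a =ᵐ[volume] zeroExtend a :=
  (memLp_zeroExtend a).coeFn_toLp

variable (p) in
/-- Multiplication by a continuous operator valued function on `[0, T]`, extended by `0`, as a
bounded linear operator on `L^p(ℝ)` which depends linearly on the multiplier. -/
def mulCut : C(Icc 0 T, F →L[ℝ] G) →L[ℝ]
    Lp F p (volume : Measure ℝ) →L[ℝ] Lp G p (volume : Measure ℝ) :=
  (ContinuousLinearMap.holderL volume ∞ p p (ContinuousLinearMap.id ℝ (F →L[ℝ] G))) ∘L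
    cutLp (F →L[ℝ] G) T ∞

theorem mulCut_ae (a : C(Icc 0 T, F →L[ℝ] G)) (g : Lp F p (volume : Measure ℝ)) :
    mulCut p a g =ᵐ[volume] fun s => zeroExtend a s (g s) := by
  have h := ContinuousLinearMap.coeFn_holder (r := p) (ContinuousLinearMap.id ℝ (F →L[ℝ] G))
    (cutLp (F →L[ℝ] G) T ∞ a) g
  filter_upwards [h, cutLp_ae (q := ∞) a] with s hs hs'
  rw [← hs']
  exact hs

/-- Multiplying an `L^p` class coming from a continuous function multiplies that function. -/
theorem mulCut_cutLp (a : C(Icc 0 T, F →L[ℝ] G)) (u : C(Icc 0 T, F)) (w : C(Icc 0 T, G))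
    (h : ∀ s, w s = a s (u s)) : mulCut p a (cutLp F T p u) = cutLp G T p w := by
  apply Lp.ext
  filter_upwards [mulCut_ae a (cutLp F T p u), cutLp_ae (q := p) u, cutLp_ae (q := p) w]
    with s h1 h2 h3
  rw [h1, h2, h3]
  by_cases hs : s ∈ Icc 0 T
  · simp only [zeroExtend_of_mem _ hs, h]
  · simp only [zeroExtend_of_notMem _ hs, map_zero]

end Cutoff

/-! ### Differentiability of a translated primitive with respect to the translation -/

section Delayed

variable {E : Type*} [NormedAddCommGroup E] [NormedSpace ℝ E] {p : ℝ≥0∞} [Fact (1 ≤ p)]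
  (R T : ℝ)

/-- The restriction of `s ↦ traj R z (s - r)` to `[0, T]`. -/
def delayed (r : ℝ) (z : E × Lp E p (volume : Measure ℝ)) : C(Icc 0 T, E) :=
  ⟨fun s => traj R z (s - r), (continuous_traj R z).comp (by fun_prop)⟩

variable {R T} in
theorem delayed_apply (r : ℝ) (z : E × Lp E p (volume : Measure ℝ)) (s : Icc 0 T) :
    delayed R T r z s = traj R z (s - r) := rfl

theorem continuous_delayed :
    Continuous fun q : ℝ × (E × Lp E p (volume : Measure ℝ)) => delayed R T q.1 q.2 := by
  apply ContinuousMap.continuous_of_continuous_uncurry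
  have := continuous_traj_uncurry (E := E) (p := p) R
  exact this.comp (f := fun x : (ℝ × (E × Lp E p (volume : Measure ℝ))) × Icc 0 T =>
    (x.1.2, (x.2 : ℝ) - x.1.1)) (by fun_prop)

/-- The map `z ↦ delayed R T r z`, as a continuous linear map into `L^p(ℝ)`. -/
def delayedLp (r : ℝ) :
    (E × Lp E p (volume : Measure ℝ)) →L[ℝ] Lp E p (volume : Measure ℝ) :=
  cutLp E T p ∘L
    { toFun := delayed R T r
      map_add' := fun z w => by ext s; exact traj_add R z w _
      map_smul' := fun c z => by ext s; exact traj_smul R c z _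
      cont := (continuous_delayed R T).comp (Continuous.prodMk_right r) }

variable {R T} in
theorem delayedLp_apply (r : ℝ) (z : E × Lp E p (volume : Measure ℝ)) :
    delayedLp R T r z = cutLp E T p (delayed R T r z) := rfl

variable (E p) in
/-- Multiplication by the indicator function of `[0, T]`. -/
def cutCLM : Lp E p (volume : Measure ℝ) →L[ℝ] Lp E p (volume : Measure ℝ) :=
  mulCut p (ContinuousMap.const (Icc 0 T) (ContinuousLinearMap.id ℝ E))

variable {T} in
theorem cutCLM_ae (g : Lp E p (volume : Measure ℝ)) :
    cutCLM E p T g =ᵐ[volume] (Icc 0 T).indicator g := by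
  filter_upwards [mulCut_ae (ContinuousMap.const (Icc 0 T) (ContinuousLinearMap.id ℝ E)) g]
    with s hs
  rw [cutCLM, hs]
  by_cases h : s ∈ Icc 0 T
  · rw [zeroExtend_of_mem _ h, indicator_of_mem h]; rfl
  · rw [zeroExtend_of_notMem _ h, indicator_of_notMem h]; rfl

variable [CompleteSpace E]

/-- A translated primitive depends on the translation through an `L^p`-valued integral: this turns
the continuity of translations in `L^p` into differentiability of translated primitives. -/
theorem delayedLp_sub (hp : p ≠ ∞) (r r' : ℝ) (z : E × Lp E p (volume : Measure ℝ)) :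
    delayedLp R T r' z - delayedLp R T r z
      = -∫ σ in r..r', cutCLM E p T (shift E p σ z.2) := by
  have hcont : Continuous fun σ => cutCLM E p T (shift E p σ z.2) :=
    (cutCLM E p T).continuous.comp ((continuous_shift hp).comp (Continuous.prodMk_left z.2))
  have hp0 : p ≠ 0 := (zero_lt_one.trans_le (Fact.out : (1 : ℝ≥0∞) ≤ p)).ne'
  apply Lp.ext
  refine Lp.ae_eq_of_forall_setIntegral_eq _ _ hp0 hp
    (fun s _ hs => Lp.integrableOn_of_measure_lt_top _ hs)
    (fun s _ hs => Lp.integrableOn_of_measure_lt_top _ hs) fun A hA hvA => ?_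
  rw [← setIntegralCLM_apply A hvA, ← setIntegralCLM_apply A hvA, map_sub, map_neg,
    ← ContinuousLinearMap.intervalIntegral_comp_comm _ (hcont.intervalIntegrable _ _)]
  simp only [setIntegralCLM_apply]
  set B : Set ℝ := Icc 0 T ∩ A with hB
  have hmB : MeasurableSet B := measurableSet_Icc.inter hA
  have hvB : volume B < ∞ := (measure_mono inter_subset_right).trans_lt hvA
  have hcut : ∀ u : ℝ → E, ∫ s in A, (Icc 0 T).indicator u s = ∫ s in B, u s := fun u => by
    rw [setIntegral_indicator measurableSet_Icc, inter_comm]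
  have h1 : ∀ σ, ∫ t in A, delayedLp R T σ z t = ∫ s in B, traj R z (s - σ) := fun σ => by
    rw [← hcut]
    refine integral_congr_ae (ae_restrict_of_ae ?_)
    filter_upwards [cutLp_ae (q := p) (delayed R T σ z)] with s hs
    rw [delayedLp_apply, hs]
    by_cases h : s ∈ Icc 0 T
    · rw [zeroExtend_of_mem _ h, indicator_of_mem h]; rfl
    · rw [zeroExtend_of_notMem _ h, indicator_of_notMem h]
  have h2 : ∀ σ, ∫ t in A, cutCLM E p T (shift E p σ z.2) t = ∫ s in B, z.2 (s - σ) := fun σ => by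
    rw [← hcut]
    refine integral_congr_ae (ae_restrict_of_ae ?_)
    filter_upwards [cutCLM_ae (T := T) (shift E p σ z.2), shift_ae σ z.2] with s hs hs'
    rw [hs]
    by_cases h : s ∈ Icc 0 T
    · rw [indicator_of_mem h, indicator_of_mem h, hs']
    · rw [indicator_of_notMem h, indicator_of_notMem h]
  have hint : ∀ σ, IntegrableOn (fun s => z.2 (s - σ)) B := fun σ =>
    (Lp.integrableOn_of_measure_lt_top (shift E p σ z.2) hvB).congr_fun_ae
      (ae_restrict_of_ae (shift_ae σ z.2))
  have hfin : IsFiniteMeasure (volume.restrict B) := ⟨by simpa using hvB⟩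
  have htraj : ∀ σ, Integrable (fun s => traj R z (s - σ)) (volume.restrict B) := fun σ => by
    have h3 : ContinuousOn (fun s => traj R z (s - σ)) (Icc 0 T) :=
      ((continuous_traj R z).comp (by fun_prop)).continuousOn
    exact (h3.integrableOn_compact isCompact_Icc).mono_set inter_subset_left
  simp only [h1, h2]
  rw [intervalIntegral_integral_swap, ← integral_sub (htraj r') (htraj r), ← integral_neg]
  · refine integral_congr_ae (Eventually.of_forall fun s => ?_)
    simp only
    rw [intervalIntegral.integral_comp_sub_left (fun σ => z.2 σ) s, traj, traj,
      add_sub_add_left_eq_sub, intervalIntegral.integral_interval_sub_left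
      (Lp.intervalIntegrable _ _ _) (Lp.intervalIntegrable _ _ _),
      intervalIntegral.integral_symm]
  · have hfin' : IsFiniteMeasure (volume.restrict (uIoc r r')) := ⟨by simp [uIoc]⟩
    have hmeas : AEStronglyMeasurable (Function.uncurry fun (σ s : ℝ) => z.2 (s - σ))
        ((volume.restrict (uIoc r r')).prod (volume.restrict B)) :=
      ((Lp.stronglyMeasurable z.2).comp_measurable
        (measurable_snd.sub measurable_fst)).aestronglyMeasurable
    rw [integrable_prod_iff hmeas]
    refine ⟨Eventually.of_forall fun σ => hint σ, ?_⟩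
    refine Integrable.of_bound (C := (1 + (volume B).toReal) * ‖z.2‖)
      hmeas.norm.integral_prod_right' (Eventually.of_forall fun σ => ?_)
    rw [Real.norm_of_nonneg (integral_nonneg fun _ => norm_nonneg _)]
    have h4 := Lp.setIntegral_norm_le (shift E p σ z.2) hvB
    rw [LinearIsometry.norm_map] at h4
    refine le_trans (le_of_eq (integral_congr_ae (ae_restrict_of_ae ?_))) h4
    filter_upwards [shift_ae σ z.2] with s hs
    rw [hs]
    rfl

end Delayed

section Smoothness

theorem continuous_toSpanSingleton {V : Type*} [NormedAddCommGroup V] [NormedSpace ℝ V] :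
    Continuous fun v : V => ContinuousLinearMap.toSpanSingleton ℝ v :=
  (ContinuousLinearMap.toSpanSingletonCLE (𝕜 := ℝ) (E := V)).continuous

variable {E : Type*} [NormedAddCommGroup E] [NormedSpace ℝ E] [CompleteSpace E]
  {p : ℝ≥0∞} [Fact (1 ≤ p)] (R T : ℝ)

theorem hasDerivAt_delayedLp (hp : p ≠ ∞) (r : ℝ) (z : E × Lp E p (volume : Measure ℝ)) :
    HasDerivAt (fun r => delayedLp R T r z) (-cutCLM E p T (shift E p r z.2)) r := by
  have hcont : Continuous fun σ => cutCLM E p T (shift E p σ z.2) :=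
    (cutCLM E p T).continuous.comp ((continuous_shift hp).comp (Continuous.prodMk_left z.2))
  have h1 := (hcont.integral_hasStrictDerivAt r r).hasDerivAt.neg.add_const (delayedLp R T r z)
  refine h1.congr_of_eventuallyEq (Eventually.of_forall fun r' => ?_)
  exact sub_eq_iff_eq_add.1 (delayedLp_sub R T hp r r' z)

theorem continuous_delayedLp (hp : p ≠ ∞) :
    Continuous fun r => delayedLp (E := E) (p := p) R T r := by
  refine (LipschitzWith.of_dist_le_mul (K := ‖cutCLM E p T‖₊) fun r' r => ?_).continuous
  rw [dist_eq_norm, coe_nnnorm, Real.dist_eq]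
  refine ContinuousLinearMap.opNorm_le_bound _ (by positivity) fun z => ?_
  rw [sub_apply, delayedLp_sub R T hp, norm_neg]
  have h1 : ∀ σ ∈ uIoc r r', ‖cutCLM E p T (shift E p σ z.2)‖ ≤ ‖cutCLM E p T‖ * ‖z‖ :=
    fun σ _ => ((cutCLM E p T).le_opNorm _).trans (by
      rw [LinearIsometry.norm_map]
      exact mul_le_mul_of_nonneg_left (norm_snd_le z) (norm_nonneg _))
  exact (intervalIntegral.norm_integral_le_of_norm_le_const h1).trans_eq (by ring)

omit [CompleteSpace E] in
theorem continuous_cutCLM_shift (hp : p ≠ ∞) :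
    Continuous fun q : ℝ × (E × Lp E p (volume : Measure ℝ)) =>
      -cutCLM E p T (shift E p q.1 q.2.2) := by
  have h1 := (continuous_shift (E := E) hp).comp
    (f := fun q : ℝ × (E × Lp E p (volume : Measure ℝ)) => (q.1, q.2.2)) (by fun_prop)
  exact ((cutCLM E p T).continuous.comp h1).neg

/-- The derivative of `(r, z) ↦ delayedLp R T r z`. -/
def delayedLpDeriv (q : ℝ × (E × Lp E p (volume : Measure ℝ))) :
    (ℝ × (E × Lp E p (volume : Measure ℝ))) →L[ℝ] Lp E p (volume : Measure ℝ) :=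
  (ContinuousLinearMap.toSpanSingleton ℝ (-cutCLM E p T (shift E p q.1 q.2.2))).coprod
    (delayedLp R T q.1)

theorem hasFDerivAt_delayedLp (hp : p ≠ ∞) (q : ℝ × (E × Lp E p (volume : Measure ℝ))) :
    HasFDerivAt (fun q : ℝ × (E × Lp E p (volume : Measure ℝ)) => delayedLp R T q.1 q.2)
      (delayedLpDeriv R T q) q := by
  have hshift := continuous_cutCLM_shift (E := E) T hp
  exact (hasStrictFDerivAt_uncurry_coprod
    (f := fun r (z : E × Lp E p (volume : Measure ℝ)) => delayedLp R T r z)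
    (f₁ := fun r z => ContinuousLinearMap.toSpanSingleton ℝ (-cutCLM E p T (shift E p r z.2)))
    (f₂ := fun r _ => delayedLp R T r)
    (Eventually.of_forall fun v => (hasDerivAt_delayedLp R T hp v.1 v.2).hasFDerivAt)
    (Eventually.of_forall fun v : ℝ × (E × Lp E p (volume : Measure ℝ)) =>
      ContinuousLinearMap.hasFDerivAt (x := v.2) (delayedLp R T v.1))
    (continuous_toSpanSingleton.comp hshift).continuousAt
    ((continuous_delayedLp R T hp).comp continuous_fst).continuousAt).hasFDerivAt

theorem continuous_delayedLpDeriv (hp : p ≠ ∞) :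
    Continuous (delayedLpDeriv (E := E) (p := p) R T) := by
  have hshift := continuous_cutCLM_shift (E := E) T hp
  have h1 := continuous_toSpanSingleton.comp hshift
  have h2 := (continuous_delayedLp (E := E) (p := p) R T hp).comp
    (continuous_fst (X := ℝ) (Y := E × Lp E p (volume : Measure ℝ)))
  have h3 := (h1.clm_comp (continuous_const (y := ContinuousLinearMap.fst ℝ ℝ
      (E × Lp E p (volume : Measure ℝ))))).add
    (h2.clm_comp (continuous_const (y := ContinuousLinearMap.snd ℝ ℝ
      (E × Lp E p (volume : Measure ℝ)))))
  refine h3.congr fun q => ?_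
  exact ContinuousLinearMap.ext fun v => by simp [delayedLpDeriv]

end Smoothness

/-! ### Substitution operators in `L^p` -/

section MeanDeriv

variable {V W : Type*} [NormedAddCommGroup V] [NormedSpace ℝ V]
  [NormedAddCommGroup W] [NormedSpace ℝ W] [CompleteSpace W]

/-- The derivative of `f`, averaged over the segment from `x` to `y`. -/
def meanDeriv (f : V → W) (x y : V) : V →L[ℝ] W :=
  ∫ θ in (0 : ℝ)..1, fderiv ℝ f (x + θ • (y - x))

omit [CompleteSpace W] in
theorem continuous_meanDeriv {f : V → W} (hf : ContDiff ℝ 1 f) :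
    Continuous fun q : V × V => meanDeriv f q.1 q.2 := by
  apply intervalIntegral.continuous_parametric_intervalIntegral_of_continuous
  · exact (hf.continuous_fderiv one_ne_zero).comp (by fun_prop)
  · exact continuous_const

theorem meanDeriv_apply {f : V → W} (hf : ContDiff ℝ 1 f) (x y : V) :
    meanDeriv f x y (y - x) = f y - f x := by
  have hcont : Continuous fun θ : ℝ => fderiv ℝ f (x + θ • (y - x)) :=
    (hf.continuous_fderiv one_ne_zero).comp (by fun_prop)
  have h1 : ∀ θ ∈ uIcc (0 : ℝ) 1, HasDerivAt (fun θ : ℝ => f (x + θ • (y - x)))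
      (fderiv ℝ f (x + θ • (y - x)) (y - x)) θ := fun θ _ => by
    have h2 : HasDerivAt (fun θ : ℝ => x + θ • (y - x)) (y - x) θ := by
      simpa using ((hasDerivAt_id θ).smul_const (y - x)).const_add x
    exact ((hf.differentiable one_ne_zero _).hasFDerivAt).comp_hasDerivAt θ h2
  rw [meanDeriv, ContinuousLinearMap.intervalIntegral_apply (hcont.intervalIntegrable _ _),
    intervalIntegral.integral_eq_sub_of_hasDerivAt h1
      ((hcont.clm_apply continuous_const).intervalIntegrable _ _)]
  simp

omit [CompleteSpace W] in
/-- If the increment of `N` is an operator applied to the increment of the differentiable map `w`,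
and the operator depends continuously on the point, then `N` is differentiable. -/
theorem hasFDerivAt_of_sub_eq_apply {X : Type*} [NormedAddCommGroup X] [NormedSpace ℝ X]
    {N : X → W} {w : X → V} {w' : X →L[ℝ] V} {B : X → V →L[ℝ] W} {x₀ : X}
    (hw : HasFDerivAt w w' x₀) (hB : ContinuousAt B x₀)
    (h : ∀ x, N x - N x₀ = B x (w x - w x₀)) : HasFDerivAt N (B x₀ ∘L w') x₀ := by
  have h1 : HasFDerivAt (fun x => B x₀ (w x - w x₀)) (B x₀ ∘L w') x₀ :=
    (B x₀).hasFDerivAt.comp x₀ (hw.sub_const _)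
  have h2 : HasFDerivAt (fun x => (B x - B x₀) (w x - w x₀)) (0 : X →L[ℝ] W) x₀ := by
    rw [hasFDerivAt_iff_isLittleO]
    simp only [sub_self, map_zero, sub_zero, zero_apply]
    have h3 : (fun x => B x - B x₀) =o[𝓝 x₀] (fun _ => (1 : ℝ)) := by
      rw [Asymptotics.isLittleO_one_iff]
      simpa using hB.sub_const (B x₀)
    have h4 : (fun x => w x - w x₀) =O[𝓝 x₀] (fun x => x - x₀) := hw.isBigO_sub
    have h5 : (fun x => (B x - B x₀) (w x - w x₀)) =O[𝓝 x₀]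
        fun x => ‖B x - B x₀‖ * ‖w x - w x₀‖ :=
      Asymptotics.IsBigO.of_bound 1 (Eventually.of_forall fun x => by
        rw [one_mul, Real.norm_of_nonneg (by positivity)]
        exact ContinuousLinearMap.le_opNorm _ _)
    have h6 := h5.trans_isLittleO (h3.norm_left.mul_isBigO h4.norm_norm)
    simpa using h6
  have h7 := (h1.add h2).add_const (N x₀)
  rw [add_zero] at h7
  refine h7.congr_of_eventuallyEq (Eventually.of_forall fun x => ?_)
  rw [← sub_eq_iff_eq_add, h x]
  simp

end MeanDeriv

section Nemytskii

variable {E : Type*} [NormedAddCommGroup E] [NormedSpace ℝ E] [CompleteSpace E]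
  {p : ℝ≥0∞} [Fact (1 ≤ p)] {R T : ℝ}

variable (p) in
/-- `(g, h) ↦ a(s)(g(s), h(s))` for an operator valued function `a` on `[0, T]`, extended by `0`. -/
def pairMul (a : C(Icc 0 T, E × E →L[ℝ] E)) :
    (Lp E p (volume : Measure ℝ) × Lp E p (volume : Measure ℝ)) →L[ℝ]
      Lp E p (volume : Measure ℝ) :=
  (mulCut p ⟨fun s => a s ∘L ContinuousLinearMap.inl ℝ E E, by fun_prop⟩) ∘L
      ContinuousLinearMap.fst ℝ _ _ +
    (mulCut p ⟨fun s => a s ∘L ContinuousLinearMap.inr ℝ E E, by fun_prop⟩) ∘L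
      ContinuousLinearMap.snd ℝ _ _

omit [CompleteSpace E] in
theorem continuous_pairMul :
    Continuous (pairMul (E := E) (T := T) p) := by
  have h1 : ∀ B : E →L[ℝ] E × E, Continuous fun a : C(Icc 0 T, E × E →L[ℝ] E) =>
      (⟨fun s => a s ∘L B, by fun_prop⟩ : C(Icc 0 T, E →L[ℝ] E)) := fun B =>
    ContinuousMap.continuous_postcomp
      (⟨fun L => L ∘L B, by fun_prop⟩ : C(E × E →L[ℝ] E, E →L[ℝ] E))
  exact ((((mulCut p).continuous.comp (h1 _)).clm_comp continuous_const).add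
    (((mulCut p).continuous.comp (h1 _)).clm_comp continuous_const))

omit [CompleteSpace E] in
theorem pairMul_cutLp (a : C(Icc 0 T, E × E →L[ℝ] E)) (u v w : C(Icc 0 T, E))
    (h : ∀ s, w s = a s (u s, v s)) :
    pairMul p a (cutLp E T p u, cutLp E T p v) = cutLp E T p w := by
  have h1 := mulCut_cutLp (p := p) (⟨fun s => a s ∘L ContinuousLinearMap.inl ℝ E E, by fun_prop⟩ :
    C(Icc 0 T, E →L[ℝ] E)) u ⟨fun s => a s (u s, 0), by fun_prop⟩ (fun s => rfl)
  have h2 := mulCut_cutLp (p := p) (⟨fun s => a s ∘L ContinuousLinearMap.inr ℝ E E, by fun_prop⟩ :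
    C(Icc 0 T, E →L[ℝ] E)) v ⟨fun s => a s (0, v s), by fun_prop⟩ (fun s => rfl)
  refine (congrArg₂ (· + ·) h1 h2).trans ?_
  rw [← map_add]
  congr 1
  ext s
  simp only [ContinuousMap.add_apply, ContinuousMap.coe_mk, h]
  rw [← map_add]
  simp

variable (R T) in
/-- The present and the delayed state `s ↦ (x(s), x(s - r))`, `0 ≤ s ≤ T`, of `x = traj R z`. -/
def statePair (q : ℝ × (E × Lp E p (volume : Measure ℝ))) : C(Icc 0 T, E × E) :=
  (delayed R T 0 q.2).prodMk (delayed R T q.1 q.2)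

omit [CompleteSpace E] in
theorem statePair_apply (q : ℝ × (E × Lp E p (volume : Measure ℝ))) (s : Icc 0 T) :
    statePair R T q s = (traj R q.2 s, traj R q.2 (s - q.1)) := by
  simp [statePair, delayed_apply]

omit [CompleteSpace E] in
theorem continuous_statePair :
    Continuous (statePair (E := E) (p := p) R T) := by
  have h := continuous_delayed (E := E) (p := p) R T
  have h0 : Continuous fun q : ℝ × (E × Lp E p (volume : Measure ℝ)) => delayed R T 0 q.2 :=
    h.comp (f := fun q : ℝ × (E × Lp E p (volume : Measure ℝ)) => ((0 : ℝ), q.2)) (by fun_prop)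
  apply ContinuousMap.continuous_of_continuous_uncurry
  simp only [statePair, Function.uncurry_def, ContinuousMap.prod_eval]
  exact ((h0.comp continuous_fst).eval continuous_snd).prodMk
    ((h.comp continuous_fst).eval continuous_snd)

variable (R T) in
/-- The present and the delayed state as elements of `L^p`. -/
def statePairLp (q : ℝ × (E × Lp E p (volume : Measure ℝ))) :
    Lp E p (volume : Measure ℝ) × Lp E p (volume : Measure ℝ) :=
  (delayedLp R T 0 q.2, delayedLp R T q.1 q.2)

variable (R T) in
/-- The derivative of `statePairLp`. -/
def statePairLpDeriv (q : ℝ × (E × Lp E p (volume : Measure ℝ))) :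
    (ℝ × (E × Lp E p (volume : Measure ℝ))) →L[ℝ]
      Lp E p (volume : Measure ℝ) × Lp E p (volume : Measure ℝ) :=
  (delayedLp R T 0 ∘L ContinuousLinearMap.snd ℝ _ _).prod (delayedLpDeriv R T q)

theorem hasFDerivAt_statePairLp (hp : p ≠ ∞) (q : ℝ × (E × Lp E p (volume : Measure ℝ))) :
    HasFDerivAt (statePairLp R T) (statePairLpDeriv R T q) q :=
  ((delayedLp R T 0).hasFDerivAt.comp q hasFDerivAt_snd).prodMk
    (hasFDerivAt_delayedLp R T hp q)

theorem continuous_statePairLpDeriv (hp : p ≠ ∞) :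
    Continuous (statePairLpDeriv (E := E) (p := p) R T) :=
  (ContinuousLinearMap.prodₗᵢ (𝕜 := ℝ) ℝ).continuous.comp
    (continuous_const.prodMk (continuous_delayedLpDeriv R T hp))

variable (f : E × E → E) (hf : ContDiff ℝ 1 f)

variable (R T) in
/-- The right-hand side `s ↦ f(x(s), x(s - r))`, `0 ≤ s ≤ T`, along `x = traj R z`. -/
def delayRhs (q : ℝ × (E × Lp E p (volume : Measure ℝ))) : C(Icc 0 T, E) :=
  (⟨f, hf.continuous⟩ : C(E × E, E)).comp (statePair R T q)

variable (R T) in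
/-- The averaged derivative of `f` between the states of two trajectories. -/
def meanCoeff (q q' : ℝ × (E × Lp E p (volume : Measure ℝ))) : C(Icc 0 T, E × E →L[ℝ] E) :=
  (⟨fun x : (E × E) × (E × E) => meanDeriv f x.1 x.2, continuous_meanDeriv hf⟩ :
    C((E × E) × (E × E), E × E →L[ℝ] E)).comp ((statePair R T q).prodMk (statePair R T q'))

omit [CompleteSpace E] in
theorem continuous_meanCoeff :
    Continuous fun x : (ℝ × (E × Lp E p (volume : Measure ℝ))) ×
      (ℝ × (E × Lp E p (volume : Measure ℝ))) => meanCoeff R T f hf x.1 x.2 := by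
  have h := continuous_statePair (E := E) (p := p) (R := R) (T := T)
  refine (ContinuousMap.continuous_postcomp _).comp ?_
  apply ContinuousMap.continuous_of_continuous_uncurry
  simp only [Function.uncurry_def, ContinuousMap.prod_eval]
  exact (((h.comp continuous_fst).comp continuous_fst).eval continuous_snd).prodMk
    (((h.comp continuous_snd).comp continuous_fst).eval continuous_snd)

theorem delayRhs_sub (q q' : ℝ × (E × Lp E p (volume : Measure ℝ))) :
    cutLp E T p (delayRhs R T f hf q') - cutLp E T p (delayRhs R T f hf q)
      = pairMul p (meanCoeff R T f hf q q') (statePairLp R T q' - statePairLp R T q) := by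
  have h1 : statePairLp R T q' - statePairLp R T q =
      (cutLp E T p (delayed R T 0 q'.2 - delayed R T 0 q.2),
        cutLp E T p (delayed R T q'.1 q'.2 - delayed R T q.1 q.2)) := by
    simp only [map_sub]; rfl
  rw [h1, ← map_sub]
  symm
  apply pairMul_cutLp
  intro s
  exact (meanDeriv_apply hf (statePair R T q s) (statePair R T q' s)).symm

theorem hasFDerivAt_delayRhs (hp : p ≠ ∞) (q : ℝ × (E × Lp E p (volume : Measure ℝ))) :
    HasFDerivAt (fun q => cutLp E T p (delayRhs R T f hf q))
      (pairMul p (meanCoeff R T f hf q q) ∘L statePairLpDeriv R T q) q :=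
  hasFDerivAt_of_sub_eq_apply (hasFDerivAt_statePairLp hp q)
    (continuous_pairMul.comp ((continuous_meanCoeff f hf).comp
      (Continuous.prodMk_right q))).continuousAt
    (fun q' => delayRhs_sub f hf q q')

theorem contDiff_delayRhs (hp : p ≠ ∞) :
    ContDiff ℝ 1 fun q : ℝ × (E × Lp E p (volume : Measure ℝ)) =>
      cutLp E T p (delayRhs R T f hf q) := by
  rw [contDiff_one_iff_hasFDerivAt]
  refine ⟨_, ?_, hasFDerivAt_delayRhs f hf hp⟩
  exact (continuous_pairMul.comp ((continuous_meanCoeff f hf).comp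
    (continuous_id.prodMk continuous_id))).clm_comp (continuous_statePairLpDeriv hp)

end Nemytskii

/-! ### Volterra operators with delay -/

section Volterra

variable {E : Type*} [NormedAddCommGroup E] [NormedSpace ℝ E] [CompleteSpace E]
  {p : ℝ≥0∞} [Fact (1 ≤ p)] {R T : ℝ}

variable (p R) in
/-- The operator `w ↦ a(s)(∫_{-R}^s w, ∫_{-R}^{s - r} w)`, `0 ≤ s ≤ T`, on `L^p(ℝ)`. -/
def volterra (a : C(Icc 0 T, E × E →L[ℝ] E)) (r : ℝ) :
    Lp E p (volume : Measure ℝ) →L[ℝ] Lp E p (volume : Measure ℝ) :=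
  pairMul p a ∘L ((delayedLp R T 0 ∘L ContinuousLinearMap.inr ℝ E _).prod
    (delayedLp R T r ∘L ContinuousLinearMap.inr ℝ E _))

omit [CompleteSpace E] in
theorem volterra_norm_le (a : C(Icc 0 T, E × E →L[ℝ] E)) {r : ℝ} (hr : r ∈ Icc 0 R)
    (w : Lp E p (volume : Measure ℝ)) :
    ∀ᵐ s, ‖volterra p R a r w s‖ ≤
      (Icc 0 T).indicator (fun s => ‖a‖ * ∫ t in (-R)..s, ‖w t‖) s := by
  have h1 : volterra p R a r w = cutLp E T p
      ⟨fun s => a s (delayed R T 0 (0, w) s, delayed R T r (0, w) s), by fun_prop⟩ :=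
    pairMul_cutLp a _ _ _ (fun s => rfl)
  rw [h1]
  filter_upwards [cutLp_ae (q := p) (⟨fun s => a s (delayed R T 0 (0, w) s,
    delayed R T r (0, w) s), by fun_prop⟩ : C(Icc 0 T, E))] with s hs
  rw [hs]
  by_cases h : s ∈ Icc 0 T
  · rw [zeroExtend_of_mem _ h, indicator_of_mem h, ContinuousMap.coe_mk]
    refine ((a ⟨s, h⟩).le_opNorm _).trans ?_
    refine mul_le_mul (a.norm_coe_le_norm _) ?_ (norm_nonneg _) (norm_nonneg a)
    have h2 : ∀ ρ ∈ Icc 0 R, ‖delayed R T ρ (0, w) ⟨s, h⟩‖ ≤ ∫ t in (-R)..s, ‖w t‖ := by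
      intro ρ hρ
      rw [delayed_apply, traj, zero_add]
      have h3 : -R ≤ s - ρ := by linarith [hρ.2, h.1]
      refine (intervalIntegral.norm_integral_le_integral_norm h3).trans ?_
      exact intervalIntegral.integral_mono_interval le_rfl h3 (by linarith [hρ.1])
        (Eventually.of_forall fun _ => norm_nonneg _) (Lp.intervalIntegrable w _ _).norm
    exact max_le (h2 0 ⟨le_rfl, hr.1.trans hr.2⟩) (h2 r hr)
  · rw [zeroExtend_of_notMem _ h, indicator_of_notMem h, norm_zero]

omit [CompleteSpace E] in
theorem integral_norm_volterra_pow_le (a : C(Icc 0 T, E × E →L[ℝ] E)) {r : ℝ} (hr : r ∈ Icc 0 R)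
    (w : Lp E p (volume : Measure ℝ)) (n : ℕ) :
    ∀ s ∈ Icc 0 T, ∫ t in (-R)..s, ‖((volterra p R a r) ^ n) w t‖ ≤
      ‖a‖ ^ n * s ^ n / n.factorial * ∫ t in (-R)..T, ‖w t‖ := by
  have hR : 0 ≤ R := hr.1.trans hr.2
  induction n with
  | zero =>
    intro s hs
    simp only [pow_zero, mul_one, Nat.factorial_zero, Nat.cast_one, div_one, one_mul]
    exact intervalIntegral.integral_mono_interval le_rfl (by linarith [hs.1]) hs.2
        (Eventually.of_forall fun _ => norm_nonneg _) (Lp.intervalIntegrable w _ _).norm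
  | succ n ih =>
    intro s hs
    set m := ∫ t in (-R)..T, ‖w t‖ with hm
    set h := ((volterra p R a r) ^ n) w with hh
    have h1 : ((volterra p R a r) ^ (n + 1)) w = volterra p R a r h := by
      rw [pow_succ']; rfl
    rw [h1]
    have hi := fun u v => (Lp.intervalIntegrable (volterra p R a r h) u v).norm
    -- The image of the Volterra operator vanishes before time `0`, so the integral starts there.
    have h2 : ∫ t in (-R)..0, ‖volterra p R a r h t‖ = 0 := by
      rw [intervalIntegral.integral_of_le (by linarith), integral_Ioc_eq_integral_Ioo]
      refine (setIntegral_congr_ae (g := fun _ => (0 : ℝ)) measurableSet_Ioo ?_).trans (by simp)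
      filter_upwards [volterra_norm_le a hr h] with t ht hmem
      rw [indicator_of_notMem (fun h => absurd h.1 (not_le.2 hmem.2))] at ht
      exact le_antisymm ht (norm_nonneg _)
    rw [← intervalIntegral.integral_add_adjacent_intervals (hi (-R) 0) (hi 0 s), h2, zero_add]
    have h3 : ∫ t in (0 : ℝ)..s, ‖volterra p R a r h t‖ ≤
        ∫ t in (0 : ℝ)..s, ‖a‖ * (‖a‖ ^ n * t ^ n / n.factorial * m) := by
      refine intervalIntegral.integral_mono_ae_restrict hs.1 (hi 0 s)
        (Continuous.intervalIntegrable (by fun_prop) _ _) ?_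
      rw [EventuallyLE, ae_restrict_iff' measurableSet_Icc]
      filter_upwards [volterra_norm_le a hr h] with t ht hmem
      have hmem' : t ∈ Icc 0 T := ⟨hmem.1, hmem.2.trans hs.2⟩
      rw [indicator_of_mem hmem'] at ht
      exact ht.trans (mul_le_mul_of_nonneg_left (ih t hmem') (norm_nonneg a))
    refine h3.trans_eq ?_
    have h4 : ∀ t : ℝ, ‖a‖ * (‖a‖ ^ n * t ^ n / n.factorial * m)
        = (‖a‖ ^ (n + 1) * m / n.factorial) * t ^ n := fun t => by ring
    simp only [h4, intervalIntegral.integral_const_mul, integral_pow]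
    rw [Nat.factorial_succ]
    push_cast
    field_simp
    simp

omit [CompleteSpace E] in
theorem norm_volterra_pow_le (hT : 0 ≤ T) (a : C(Icc 0 T, E × E →L[ℝ] E)) {r : ℝ}
    (hr : r ∈ Icc 0 R) (n : ℕ) :
    ‖(volterra p R a r) ^ (n + 1)‖ ≤
      cutConst T p * ‖a‖ * (1 + (T + R)) * ((‖a‖ * T) ^ n / n.factorial) := by
  have hR : 0 ≤ R := hr.1.trans hr.2
  refine ContinuousLinearMap.opNorm_le_bound _
    (mul_nonneg (mul_nonneg (mul_nonneg cutConst_nonneg (norm_nonneg a)) (by linarith))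
      (by positivity)) fun w => ?_
  have hm : ∫ t in (-R)..T, ‖w t‖ ≤ (1 + (T + R)) * ‖w‖ := by
    have := Lp.integral_norm_le w (a := -R) (b := T) (by linarith)
    rwa [sub_neg_eq_add] at this
  have hc : 0 ≤ ‖a‖ * (‖a‖ ^ n * T ^ n / n.factorial * ((1 + (T + R)) * ‖w‖)) := by positivity
  have h1 : ((volterra p R a r) ^ (n + 1)) w = volterra p R a r (((volterra p R a r) ^ n) w) := by
    rw [pow_succ']; rfl
  rw [h1]
  refine (Lp.norm_le_of_le_indicator (T := T) _ hc ?_).trans_eq (by rw [mul_pow]; ring)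
  filter_upwards [volterra_norm_le a hr (((volterra p R a r) ^ n) w)] with s hs
  refine hs.trans ?_
  by_cases h : s ∈ Icc 0 T
  · rw [indicator_of_mem h, indicator_of_mem h]
    refine mul_le_mul_of_nonneg_left ?_ (norm_nonneg a)
    refine (integral_norm_volterra_pow_le a hr w n s h).trans ?_
    have := h.1
    gcongr
    · exact intervalIntegral.integral_nonneg (by linarith) fun _ _ => norm_nonneg _
    · exact h.2
  · rw [indicator_of_notMem h, indicator_of_notMem h]

/-- Powers of a Volterra operator decay factorially, so `1` is not in its spectrum. -/
theorem isUnit_one_sub_volterra (hT : 0 ≤ T) (a : C(Icc 0 T, E × E →L[ℝ] E)) {r : ℝ}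
    (hr : r ∈ Icc 0 R) : IsUnit (1 - volterra p R a r) := by
  have h1 : Tendsto (fun n : ℕ => cutConst T p * ‖a‖ * (1 + (T + R)) *
      ((‖a‖ * T) ^ n / n.factorial)) atTop (𝓝 0) := by
    simpa using (FloorSemiring.tendsto_pow_div_factorial_atTop (‖a‖ * T)).const_mul
      (cutConst T p * ‖a‖ * (1 + (T + R)))
  obtain ⟨n, hn⟩ := (h1.eventually (gt_mem_nhds zero_lt_one)).exists
  have h2 : IsUnit (1 - (volterra p R a r) ^ (n + 1)) :=
    isUnit_one_sub_of_norm_lt_one ((norm_volterra_pow_le hT a hr n).trans_lt hn)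
  have h3 := mul_neg_geom_sum (volterra p R a r) (n + 1)
  have h4 := (Commute.refl (volterra p R a r)).sub_left (Commute.one_left _)
  rw [← h3, Commute.isUnit_mul_iff] at h2
  · exact h2.1
  · exact Commute.sum_right _ _ _ fun i _ =>
      ((Commute.one_left _).sub_left ((Commute.refl _).pow_right i))

end Volterra

/-! ### The delay equation as an equation for the derivative in `L^p` -/

section DerivativeEquation

variable {E : Type*} [NormedAddCommGroup E] [NormedSpace ℝ E] [CompleteSpace E]
  {p : ℝ≥0∞} [Fact (1 ≤ p)] (R T : ℝ) (f : E × E → E) (hf : ContDiff ℝ 1 f)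

/-- Adding `v` to the derivative of the trajectory, with the delay and the value at `-R`
unchanged. -/
def addDeriv (q : ℝ × (E × Lp E p (volume : Measure ℝ))) (v : Lp E p (volume : Measure ℝ)) :
    ℝ × (E × Lp E p (volume : Measure ℝ)) :=
  (q.1, (q.2.1, q.2.2 + v))

/-- `v ∈ L^p(ℝ)` is the derivative, on `[0, T]`, of a solution of the delay equation with the delay
`q.1` whose prehistory is `traj R q.2`. -/
def SolvesDeriv (q : ℝ × (E × Lp E p (volume : Measure ℝ)))
    (v : Lp E p (volume : Measure ℝ)) : Prop :=
  v = cutLp E T p (delayRhs R T f hf (addDeriv q v))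

variable {R T f hf}

omit [CompleteSpace E] in
theorem statePairLp_addDeriv_sub (q : ℝ × (E × Lp E p (volume : Measure ℝ)))
    (v v' : Lp E p (volume : Measure ℝ)) :
    statePairLp R T (addDeriv q v') - statePairLp R T (addDeriv q v) =
      ((delayedLp R T 0 ∘L ContinuousLinearMap.inr ℝ E _).prod
        (delayedLp R T q.1 ∘L ContinuousLinearMap.inr ℝ E _)) (v' - v) := by
  have h1 : ((q.2.1, q.2.2 + v') : E × Lp E p (volume : Measure ℝ)) - (q.2.1, q.2.2 + v)
      = (0, v' - v) := by
    ext1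
    · simp
    · simp
  have h2 : statePairLp R T (addDeriv q v') - statePairLp R T (addDeriv q v) =
    (delayedLp R T 0 (q.2.1, q.2.2 + v') - delayedLp R T 0 (q.2.1, q.2.2 + v),
      delayedLp R T q.1 (q.2.1, q.2.2 + v') - delayedLp R T q.1 (q.2.1, q.2.2 + v)) := rfl
  rw [h2, ← map_sub, ← map_sub, h1]
  rfl

theorem SolvesDeriv.unique (hT : 0 ≤ T) {q : ℝ × (E × Lp E p (volume : Measure ℝ))}
    (hr : q.1 ∈ Icc 0 R) {v v' : Lp E p (volume : Measure ℝ)}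
    (h : SolvesDeriv R T f hf q v) (h' : SolvesDeriv R T f hf q v') : v' = v := by
  have h1 := delayRhs_sub (R := R) (T := T) f hf (addDeriv q v) (addDeriv q v')
  rw [← h, ← h', statePairLp_addDeriv_sub] at h1
  set a := meanCoeff R T f hf (addDeriv q v) (addDeriv q v')
  have h2 : (1 - volterra p R a q.1) (v' - v) = 0 := by
    rw [sub_apply, one_apply_eq_self, sub_eq_zero]
    exact h1
  obtain ⟨u, hu⟩ := isUnit_one_sub_volterra (p := p) hT a hr
  have h3 : (↑u⁻¹ * (1 - volterra p R a q.1)) (v' - v) = 0 := by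
    rw [mul_apply_eq_comp, h2, map_zero]
  rw [← hu, Units.inv_mul, one_apply_eq_self] at h3
  exact sub_eq_zero.1 h3

/-- The linearization of the derivative equation is an invertible Volterra operator, so the implicit
function theorem solves the equation near any given solution on the same time interval. -/
theorem SolvesDeriv.exists_contDiffAt (hp : p ≠ ∞) (hT : 0 ≤ T)
    {q : ℝ × (E × Lp E p (volume : Measure ℝ))} (hr : q.1 ∈ Icc 0 R)
    {v : Lp E p (volume : Measure ℝ)} (h : SolvesDeriv R T f hf q v) :
    ∃ S : ℝ × (E × Lp E p (volume : Measure ℝ)) → Lp E p (volume : Measure ℝ),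
      ContDiffAt ℝ 1 S q ∧ S q = v ∧ ∀ᶠ q' in 𝓝 q, SolvesDeriv R T f hf q' (S q') := by
  let ι : Lp E p (volume : Measure ℝ) →L[ℝ] ℝ × (E × Lp E p (volume : Measure ℝ)) :=
    ContinuousLinearMap.inr ℝ ℝ _ ∘L ContinuousLinearMap.inr ℝ E _
  let Λ : ((ℝ × (E × Lp E p (volume : Measure ℝ))) × Lp E p (volume : Measure ℝ)) →L[ℝ]
      ℝ × (E × Lp E p (volume : Measure ℝ)) :=
    ContinuousLinearMap.fst ℝ _ _ + ι ∘L ContinuousLinearMap.snd ℝ _ _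
  have hΛ : ∀ x, Λ x = addDeriv x.1 x.2 := fun x => by
    refine Prod.ext ?_ (Prod.ext ?_ ?_)
    · exact add_zero _
    · exact add_zero _
    · rfl
  let N : ℝ × (E × Lp E p (volume : Measure ℝ)) → Lp E p (volume : Measure ℝ) :=
    fun q => cutLp E T p (delayRhs R T f hf q)
  let Ψ : (ℝ × (E × Lp E p (volume : Measure ℝ))) × Lp E p (volume : Measure ℝ) →
      Lp E p (volume : Measure ℝ) := fun x => x.2 - N (Λ x)
  have hΨ : ∀ x, Ψ x = 0 ↔ SolvesDeriv R T f hf x.1 x.2 := fun x => by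
    change x.2 - N (Λ x) = 0 ↔ _
    rw [sub_eq_zero, hΛ]
    rfl
  have hN : ContDiff ℝ 1 N := contDiff_delayRhs f hf hp
  have hcd : ContDiff ℝ 1 Ψ := contDiff_snd.sub (hN.comp Λ.contDiff)
  have hd : HasFDerivAt Ψ (ContinuousLinearMap.snd ℝ _ _ -
      (pairMul p (meanCoeff R T f hf (Λ (q, v)) (Λ (q, v))) ∘L statePairLpDeriv R T (Λ (q, v))) ∘L Λ)
      (q, v) :=
    hasFDerivAt_snd.sub ((hasFDerivAt_delayRhs f hf hp (Λ (q, v))).comp (q, v) Λ.hasFDerivAt)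
  have hpart : fderiv ℝ Ψ (q, v) ∘L ContinuousLinearMap.inr ℝ _ _ =
      1 - volterra p R (meanCoeff R T f hf (Λ (q, v)) (Λ (q, v))) q.1 := by
    rw [hd.fderiv]
    refine ContinuousLinearMap.ext fun w => ?_
    have h1 : Λ ((0 : ℝ × (E × Lp E p (volume : Measure ℝ))), w) = (0, (0, w)) := by
      rw [hΛ]
      simp [addDeriv]
    have h2 : statePairLpDeriv R T (Λ (q, v)) (0, (0, w)) =
        (delayedLp R T 0 (0, w), delayedLp R T q.1 (0, w)) := by
      refine Prod.ext rfl ?_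
      change delayedLpDeriv R T (Λ (q, v)) (0, (0, w)) = _
      rw [hΛ, delayedLpDeriv, ContinuousLinearMap.coprod_apply, map_zero, zero_add]
      rfl
    change w - pairMul p _ (statePairLpDeriv R T (Λ (q, v)) (Λ (0, w))) = _
    rw [h1, h2]
    rfl
  have hinv : (fderiv ℝ Ψ (q, v) ∘L ContinuousLinearMap.inr ℝ _ _).IsInvertible := by
    rw [hpart]
    obtain ⟨u, hu⟩ := isUnit_one_sub_volterra (p := p) hT
      (meanCoeff R T f hf (Λ (q, v)) (Λ (q, v))) hr
    exact ⟨ContinuousLinearEquiv.unitsEquiv ℝ _ u, hu⟩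
  have hcda : ContDiffAt ℝ 1 Ψ (q, v) := hcd.contDiffAt
  refine ⟨hcda.implicitFunction one_ne_zero hinv, hcda.contDiffAt_implicitFunction one_ne_zero hinv,
    hcda.implicitFunction_apply_self one_ne_zero hinv, ?_⟩
  filter_upwards [hcda.eventually_apply_implicitFunction one_ne_zero hinv] with q' hq'
  rw [(hΨ (q, v)).2 h] at hq'
  exact (hΨ _).1 hq'

end DerivativeEquation

/-! ### Sobolev functions as primitives -/

theorem AbsolutelyContinuousOnInterval.of_dist_le {X Y : Type*} [PseudoMetricSpace X]
    [PseudoMetricSpace Y] {f : ℝ → X} {g : ℝ → Y} {a b : ℝ}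
    (hg : AbsolutelyContinuousOnInterval g a b)
    (h : ∀ x ∈ uIcc a b, ∀ y ∈ uIcc a b, dist (f x) (f y) ≤ dist (g x) (g y)) :
    AbsolutelyContinuousOnInterval f a b := by
  rw [absolutelyContinuousOnInterval_iff] at hg ⊢
  intro ε hε
  obtain ⟨δ, hδ, H⟩ := hg ε hε
  exact ⟨δ, hδ, fun I hI hIδ => (Finset.sum_le_sum fun i hi =>
    h _ (hI.1 i hi).1 _ (hI.1 i hi).2).trans_lt (H I hI hIδ)⟩

section SobolevPrimitive

variable {E : Type*} [NormedAddCommGroup E] [NormedSpace ℝ E] [FiniteDimensional ℝ E]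
  {p : ℝ≥0∞} [Fact (1 ≤ p)] {R : ℝ}

omit [FiniteDimensional ℝ E] in
theorem absolutelyContinuousOnInterval_traj (z : E × Lp E p (volume : Measure ℝ)) (a b : ℝ) :
    AbsolutelyContinuousOnInterval (traj R z) a b := by
  have h1 := (Lp.intervalIntegrable z.2 a b).norm.absolutelyContinuousOnInterval_intervalIntegral
    (c := a) left_mem_uIcc
  refine h1.of_dist_le fun x _ y _ => ?_
  have hi := Lp.intervalIntegrable z.2
  rw [dist_eq_norm, dist_eq_norm, traj, traj, add_sub_add_left_eq_sub,
    intervalIntegral.integral_interval_sub_left (hi _ _) (hi _ _),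
    intervalIntegral.integral_interval_sub_left (hi _ _).norm (hi _ _).norm]
  exact intervalIntegral.norm_integral_le_abs_integral_norm

theorem ae_hasDerivAt_traj (z : E × Lp E p (volume : Measure ℝ)) :
    ∀ᵐ t, HasDerivAt (traj R z) (z.2 t) t := by
  have h1 : LocallyIntegrable z.2 (volume : Measure ℝ) :=
    (Lp.memLp z.2).locallyIntegrable Fact.out
  filter_upwards [LocallyIntegrable.ae_hasDerivAt_integral h1] with t ht
  exact (ht (-R)).const_add z.1

omit [FiniteDimensional ℝ E] in
theorem deriv_zeroExtend_ae {φ : Icc (-R) 0 → E} {u u' : ℝ → E}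
    (h : ∀ t : Icc (-R) 0, φ t = u t) (hu : ∀ᵐ t, HasDerivAt u (u' t) t) :
    deriv (zeroExtend φ) =ᵐ[volume.restrict (Icc (-R) 0)] u' := by
  rw [← restrict_Ioo_eq_restrict_Icc, EventuallyEq, ae_restrict_iff' measurableSet_Ioo]
  filter_upwards [hu] with t ht hmem
  have h1 : zeroExtend φ =ᶠ[𝓝 t] u := by
    filter_upwards [Icc_mem_nhds hmem.1 hmem.2] with s hs
    rw [zeroExtend_of_mem _ hs, h]
  rw [h1.deriv_eq, ht.deriv]

theorem traj_mem_sobolevSubmodule (z : E × Lp E p (volume : Measure ℝ)) :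
    (fun θ : Icc (-R) 0 => traj R z θ) ∈ sobolevSubmodule E (-R) 0 p := by
  constructor
  · rcases le_or_gt (-R) 0 with hR | hR
    · refine (absolutelyContinuousOnInterval_traj (R := R) z (-R) 0).of_dist_le fun x hx y hy => ?_
      rw [uIcc_of_le hR] at hx hy
      rw [zeroExtend_of_mem _ hx, zeroExtend_of_mem _ hy]
    · refine (absolutelyContinuousOnInterval_traj (R := R) z (-R) 0).of_dist_le fun x hx y hy => ?_
      have h0 : ∀ t, zeroExtend (fun θ : Icc (-R) 0 => traj R z θ) t = 0 := fun t =>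
        zeroExtend_of_notMem _ fun h => absurd (h.1.trans h.2) (not_le.2 hR)
      rw [h0, h0, dist_self]
      exact dist_nonneg
  · exact (memLp_congr_ae (deriv_zeroExtend_ae (fun _ => rfl) (ae_hasDerivAt_traj z))).2
      ((Lp.memLp z.2).restrict _)

/-- The element `θ ↦ c + ∫_{-R}^θ g` of the Sobolev type space, for `z = (c, g)`. -/
def SobolevW.ofTraj (R : ℝ) (z : E × Lp E p (volume : Measure ℝ)) : SobolevW E (-R) 0 p :=
  (show SobolevW E (-R) 0 p from ⟨fun θ => traj R z θ, traj_mem_sobolevSubmodule z⟩)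

theorem SobolevW.ofTraj_apply (z : E × Lp E p (volume : Measure ℝ)) {t : ℝ}
    (ht : t ∈ Icc (-R) 0) : SobolevW.ofTraj R z t = traj R z t :=
  zeroExtend_of_mem _ ht

theorem sobolevEmbedding_ofTraj (hR : 0 ≤ R) (z : E × Lp E p (volume : Measure ℝ)) :
    sobolevEmbedding E (-R) 0 p (SobolevW.ofTraj R z) =
      WithLp.toLp p (z.1, LpToLpRestrictCLM ℝ E ℝ volume p (Icc (-R) 0) z.2) := by
  refine congrArg (WithLp.toLp p) (Prod.ext ?_ ?_)
  · refine (SobolevW.ofTraj_apply z ⟨le_rfl, by linarith⟩).trans ?_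
    simp [traj]
  · refine Lp.ext ((MemLp.coeFn_toLp (SobolevW.ofTraj R z).memLp_deriv).trans ?_)
    exact (deriv_zeroExtend_ae (fun _ => rfl) (ae_hasDerivAt_traj z)).trans
      (LpToLpRestrictCLM_coeFn ℝ _ _).symm

variable (E p) in
/-- `SobolevW.ofTraj` as a continuous linear map. -/
def SobolevW.ofTrajCLM (hR : 0 ≤ R) :
    (E × Lp E p (volume : Measure ℝ)) →L[ℝ] SobolevW E (-R) 0 p :=
  LinearMap.mkContinuous
    { toFun := SobolevW.ofTraj R
      map_add' := fun z w => SobolevW.ext (funext fun _ => traj_add R z w _)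
      map_smul' := fun c z => SobolevW.ext (funext fun _ => traj_smul R c z _) }
    ‖(WithLp.prodContinuousLinearEquiv p ℝ E
        (Lp E p (volume.restrict (Icc (-R) 0)))).symm.toContinuousLinearMap ∘L
      (ContinuousLinearMap.fst ℝ E (Lp E p (volume : Measure ℝ))).prod
        (LpToLpRestrictCLM ℝ E ℝ volume p (Icc (-R) 0) ∘L ContinuousLinearMap.snd ℝ E _)‖
    (fun z => by
      have h1 : ‖SobolevW.ofTraj R z‖ = ‖sobolevEmbedding E (-R) 0 p (SobolevW.ofTraj R z)‖ := rfl
      refine h1.trans_le ?_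
      rw [sobolevEmbedding_ofTraj hR]
      exact ContinuousLinearMap.le_opNorm (((WithLp.prodContinuousLinearEquiv p ℝ E
        (Lp E p (volume.restrict (Icc (-R) 0)))).symm.toContinuousLinearMap) ∘L
      (ContinuousLinearMap.fst ℝ E (Lp E p (volume : Measure ℝ))).prod
        (LpToLpRestrictCLM ℝ E ℝ volume p (Icc (-R) 0) ∘L ContinuousLinearMap.snd ℝ E _)) z)

omit [Fact (1 ≤ p)] in
theorem SobolevW.memLp_indicator_deriv (φ : SobolevW E (-R) 0 p) :
    MemLp ((Icc (-R) 0).indicator (deriv ⇑φ)) p volume :=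
  (memLp_indicator_iff_restrict measurableSet_Icc).2 φ.memLp_deriv

theorem SobolevW.norm_value_le (φ : SobolevW E (-R) 0 p) : ‖φ (-R)‖ ≤ ‖φ‖ :=
  WithLp.norm_fst_le _ (sobolevEmbedding E (-R) 0 p φ)

theorem SobolevW.norm_deriv_le (φ : SobolevW E (-R) 0 p) :
    ‖φ.memLp_indicator_deriv.toLp _‖ ≤ ‖φ‖ := by
  have h1 : ‖φ.memLp_deriv.toLp _‖ ≤ ‖φ‖ :=
    WithLp.norm_snd_le _ (sobolevEmbedding E (-R) 0 p φ)
  rw [Lp.norm_toLp] at h1 ⊢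
  rwa [eLpNorm_indicator_eq_eLpNorm_restrict measurableSet_Icc]

variable (E p R) in
/-- The map `φ ↦ (φ(-R), φ')`, with `φ'` extended by `0` to the real line. -/
def SobolevW.toPair : SobolevW E (-R) 0 p →L[ℝ] E × Lp E p (volume : Measure ℝ) :=
  LinearMap.mkContinuous
    { toFun := fun φ => (φ (-R), φ.memLp_indicator_deriv.toLp _)
      map_add' := fun φ ψ => by
        refine Prod.ext (congrFun (zeroExtend_add φ.toFun ψ.toFun) (-R)) ?_
        refine Eq.trans ?_ (MemLp.toLp_add φ.memLp_indicator_deriv ψ.memLp_indicator_deriv)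
        refine MemLp.toLp_congr (φ + ψ).memLp_indicator_deriv _ ?_
        rw [← indicator_add']
        exact (ae_eq_restrict_iff_indicator_ae_eq measurableSet_Icc).1
          (deriv_zeroExtend_add φ.absolutelyContinuous ψ.absolutelyContinuous)
      map_smul' := fun c φ => by
        refine Prod.ext (congrFun (zeroExtend_smul c φ.toFun) (-R)) ?_
        refine Eq.trans ?_ (MemLp.toLp_const_smul c φ.memLp_indicator_deriv)
        refine MemLp.toLp_congr (c • φ).memLp_indicator_deriv _ ?_
        rw [show c • (Icc (-R) 0).indicator (deriv ⇑φ) = (Icc (-R) 0).indicator (c • deriv ⇑φ) from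
          (indicator_const_smul _ _ _).symm]
        exact (ae_eq_restrict_iff_indicator_ae_eq measurableSet_Icc).1
          (deriv_zeroExtend_smul c φ.absolutelyContinuous) }
    1 (fun φ => by
      rw [one_mul]
      exact max_le φ.norm_value_le φ.norm_deriv_le)

theorem SobolevW.toPair_snd_ae (φ : SobolevW E (-R) 0 p) :
    (SobolevW.toPair E p R φ).2 =ᵐ[volume] (Icc (-R) 0).indicator (deriv ⇑φ) :=
  φ.memLp_indicator_deriv.coeFn_toLp

/-- An absolutely continuous function is the primitive of its derivative. -/
theorem SobolevW.traj_toPair (φ : SobolevW E (-R) 0 p) {t : ℝ} (ht : t ∈ Icc (-R) 0) :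
    traj R (SobolevW.toPair E p R φ) t = φ t := by
  have hR : -R ≤ 0 := ht.1.trans ht.2
  have h1 : AbsolutelyContinuousOnInterval (traj R (SobolevW.toPair E p R φ) - ⇑φ) (-R) 0 :=
    (absolutelyContinuousOnInterval_traj _ _ _).sub φ.absolutelyContinuous
  have h2 := zeroExtend_ae_differentiableAt φ.absolutelyContinuous
  rw [ae_restrict_iff' measurableSet_Icc] at h2
  obtain ⟨C, hC⟩ := h1.const_of_ae_hasDerivAt_zero (by
    filter_upwards [h2, φ.toPair_snd_ae, ae_hasDerivAt_traj (R := R) (SobolevW.toPair E p R φ)]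
      with s h3 h4 h5 hs
    rw [uIcc_of_le hR] at hs
    rw [h4, indicator_of_mem hs] at h5
    simpa using h5.sub (h3 hs).hasDerivAt)
  have h3 := hC (-R) left_mem_uIcc
  have h4 := hC t (by rwa [uIcc_of_le hR])
  have h5 : traj R (SobolevW.toPair E p R φ) (-R) = φ (-R) := by
    rw [traj, intervalIntegral.integral_same, add_zero]
    rfl
  rw [Pi.sub_apply, h5, sub_self] at h3
  rw [Pi.sub_apply, ← h3, sub_eq_zero] at h4
  exact h4

end SobolevPrimitive

/-! ### Solutions of the delay equation -/

section Solutions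

variable {E : Type*} [NormedAddCommGroup E] [NormedSpace ℝ E] [FiniteDimensional ℝ E]
  {p : ℝ≥0∞} [Fact (1 ≤ p)] {R T r : ℝ} {f : E × E → E} {hf : ContDiff ℝ 1 f}

omit [FiniteDimensional ℝ E] in
theorem integral_cutLp_of_nonpos (w : C(Icc 0 T, E)) {a b : ℝ} (ha : a ≤ 0) (hb : b ≤ 0) :
    ∫ s in a..b, cutLp E T p w s = 0 := by
  refine (intervalIntegral.integral_congr_ae (g := fun _ => (0 : E)) ?_).trans (by simp)
  have h0 : ∀ᵐ s : ℝ, s ≠ 0 := by simp [ae_iff, measure_singleton]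
  filter_upwards [cutLp_ae (q := p) w, h0] with s hs hs0 hmem
  rw [hs]
  refine zeroExtend_of_notMem _ fun h => hs0 (le_antisymm ?_ h.1)
  exact hmem.2.trans (max_le ha hb)

omit [FiniteDimensional ℝ E] in
theorem traj_addDeriv (q : ℝ × (E × Lp E p (volume : Measure ℝ)))
    (v : Lp E p (volume : Measure ℝ)) (t : ℝ) :
    traj R (addDeriv q v).2 t = traj R q.2 t + ∫ s in (-R)..t, v s := by
  simp only [addDeriv, traj, Lp.integral_add_apply, add_assoc]

theorem traj_addDeriv_cutLp_of_nonpos (hR : 0 ≤ R) (φ : SobolevW E (-R) 0 p) (w : C(Icc 0 T, E))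
    {t : ℝ} (ht : t ∈ Icc (-R) 0) :
    traj R (addDeriv (r, SobolevW.toPair E p R φ) (cutLp E T p w)).2 t = φ t := by
  rw [traj_addDeriv, integral_cutLp_of_nonpos w (by linarith) ht.2, add_zero, φ.traj_toPair ht]

theorem traj_addDeriv_cutLp (hR : 0 ≤ R) (φ : SobolevW E (-R) 0 p) (w : C(Icc 0 T, E))
    {t : ℝ} (ht : t ∈ Icc 0 T) :
    traj R (addDeriv (r, SobolevW.toPair E p R φ) (cutLp E T p w)).2 t =
      φ 0 + ∫ s in (0 : ℝ)..t, zeroExtend w s := by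
  have h1 : traj R (SobolevW.toPair E p R φ) t = φ 0 := by
    have hi := Lp.intervalIntegrable (SobolevW.toPair E p R φ).2
    rw [← φ.traj_toPair ⟨by linarith, le_rfl⟩, ← sub_eq_zero, traj, traj, add_sub_add_left_eq_sub,
      intervalIntegral.integral_interval_sub_left (hi _ _) (hi _ _)]
    refine (intervalIntegral.integral_congr_ae (g := fun _ => (0 : E)) ?_).trans (by simp)
    filter_upwards [φ.toPair_snd_ae] with s hs hmem
    rw [hs, indicator_of_notMem]
    rw [uIoc_of_le ht.1] at hmem
    exact fun h => absurd h.2 (not_le.2 hmem.1)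
  have hi := Lp.intervalIntegrable (cutLp E T p w)
  rw [traj_addDeriv, ← intervalIntegral.integral_add_adjacent_intervals (hi (-R) 0) (hi 0 t),
    integral_cutLp_of_nonpos w (by linarith) le_rfl, zero_add]
  refine congrArg₂ (· + ·) h1 (intervalIntegral.integral_congr_ae ?_)
  filter_upwards [cutLp_ae (q := p) w] with s hs _ using hs

theorem SolvesDeriv.isDelaySolution (hR : 0 ≤ R) (hT : 0 < T)
    {φ : SobolevW E (-R) 0 p} {v : Lp E p (volume : Measure ℝ)}
    (h : SolvesDeriv R T f hf (r, SobolevW.toPair E p R φ) v) :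
    IsDelaySolution f R r φ (ENNReal.ofReal T)
      (traj R (addDeriv (r, SobolevW.toPair E p R φ) v).2) := by
  set z := (addDeriv (r, SobolevW.toPair E p R φ) v).2 with hz
  set w := delayRhs R T f hf (addDeriv (r, SobolevW.toPair E p R φ) v) with hw
  have hv : v = cutLp E T p w := h
  refine ⟨ENNReal.ofReal_pos.2 hT, fun θ hθ => ?_, fun t ht htT => ?_⟩
  · rw [hz, hv]
    exact traj_addDeriv_cutLp_of_nonpos hR φ w hθ
  · have htT' : t < T := (ENNReal.ofReal_lt_ofReal_iff hT).1 htT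
    have hF : Continuous fun s => f (traj R z s, traj R z (s - r)) :=
      hf.continuous.comp ((continuous_traj R z).prodMk
        ((continuous_traj R z).comp (continuous_sub_right r)))
    have h1 := ((hF.integral_hasStrictDerivAt 0 t).hasDerivAt.const_add (φ 0)).hasDerivWithinAt
      (s := Ici 0)
    have h2 : ∀ s ∈ Icc 0 T, traj R z s =
        φ 0 + ∫ u in (0 : ℝ)..s, f (traj R z u, traj R z (u - r)) := fun s hs => by
      have h3 : traj R z s = φ 0 + ∫ u in (0 : ℝ)..s, zeroExtend w u := by
        rw [hz, hv]
        exact traj_addDeriv_cutLp hR φ w hs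
      rw [h3]
      congr 1
      refine intervalIntegral.integral_congr fun u hu => ?_
      rw [uIcc_of_le hs.1] at hu
      have hu' : u ∈ Icc 0 T := ⟨hu.1, hu.2.trans hs.2⟩
      rw [zeroExtend_of_mem _ hu']
      exact congrArg f (statePair_apply _ _)
    refine h1.congr_of_eventuallyEq ?_ (h2 t ⟨ht, htT'.le⟩)
    filter_upwards [self_mem_nhdsWithin, mem_nhdsWithin_of_mem_nhds (Iio_mem_nhds htT')]
      with s hs hs'
    exact h2 s ⟨hs, le_of_lt hs'⟩

omit [Fact (1 ≤ p)] in
theorem IsDelaySolution.continuousOn {φ : SobolevW E (-R) 0 p} {T' : ℝ≥0∞} {y : ℝ → E}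
    (hR : 0 ≤ R) (hy : IsDelaySolution f R r φ T' y) (hTT' : ENNReal.ofReal T < T') :
    ContinuousOn y (Icc (-R) T) := by
  have h1 : ContinuousOn y (Icc (-R) 0) := by
    have h2 := φ.absolutelyContinuous.continuousOn
    rw [uIcc_of_le (by linarith)] at h2
    exact h2.congr hy.initial
  have h2 : ContinuousOn y (Icc 0 T) := fun t ht =>
    ((hy.hasDeriv t ht.1 ((ENNReal.ofReal_le_ofReal ht.2).trans_lt hTT')).continuousWithinAt).mono
      Icc_subset_Ici_self
  exact (h1.union_of_isClosed h2 isClosed_Icc isClosed_Icc).mono Icc_subset_Icc_union_Icc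

theorem IsDelaySolution.exists_solvesDeriv (hf : ContDiff ℝ 1 f) (hr : r ∈ Icc 0 R)
    {φ : SobolevW E (-R) 0 p} {T' : ℝ≥0∞} {y : ℝ → E} (hy : IsDelaySolution f R r φ T' y)
    (hTT' : ENNReal.ofReal T < T') :
    ∃ v : Lp E p (volume : Measure ℝ), SolvesDeriv R T f hf (r, SobolevW.toPair E p R φ) v ∧
      ∀ t ∈ Icc (-R) T, traj R (addDeriv (r, SobolevW.toPair E p R φ) v).2 t = y t := by
  have hR : 0 ≤ R := hr.1.trans hr.2
  have hcont := hy.continuousOn hR hTT'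
  have hF : ContinuousOn (fun s => f (y s, y (s - r))) (Icc 0 T) := by
    refine hf.continuous.comp_continuousOn ((hcont.mono (Icc_subset_Icc_left (by linarith))).prodMk
      (hcont.comp (by fun_prop) fun s hs => ⟨?_, ?_⟩))
    · linarith [hs.1, hr.2]
    · linarith [hs.2, hr.1]
  let w : C(Icc 0 T, E) :=
    ⟨fun s => f (y s, y (s - r)), continuousOn_iff_continuous_domRestrict.1 hF⟩
  have hw : ∀ s ∈ Icc 0 T, zeroExtend w s = f (y s, y (s - r)) := fun s hs =>
    zeroExtend_of_mem _ hs
  have key : ∀ t ∈ Icc (-R) T,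
      traj R (addDeriv (r, SobolevW.toPair E p R φ) (cutLp E T p w)).2 t = y t := fun t ht => by
    rcases le_total t 0 with h0 | h0
    · rw [traj_addDeriv_cutLp_of_nonpos hR φ w ⟨ht.1, h0⟩, hy.initial t ⟨ht.1, h0⟩]
    · rw [traj_addDeriv_cutLp hR φ w ⟨h0, ht.2⟩]
      have hsub : uIcc 0 t ⊆ Icc 0 T := by
        rw [uIcc_of_le h0]
        exact Icc_subset_Icc_right ht.2
      have h1 : ∫ s in (0 : ℝ)..t, zeroExtend w s = ∫ s in (0 : ℝ)..t, f (y s, y (s - r)) :=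
        intervalIntegral.integral_congr fun s hs => hw s (hsub hs)
      rw [h1, intervalIntegral.integral_eq_sub_of_hasDeriv_right (f := y),
        hy.initial 0 ⟨by linarith, le_rfl⟩, add_sub_cancel]
      · exact hcont.mono (hsub.trans (Icc_subset_Icc_left (by linarith)))
      · intro s hs
        rw [min_eq_left h0, max_eq_right h0] at hs
        exact (hy.hasDeriv s hs.1.le ((ENNReal.ofReal_le_ofReal
          (hs.2.le.trans ht.2)).trans_lt hTT')).mono (Ioi_subset_Ici hs.1.le)
      · exact (hF.mono hsub).intervalIntegrable
  refine ⟨cutLp E T p w, ?_, key⟩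
  refine congrArg (cutLp E T p) (ContinuousMap.ext fun s => ?_)
  change f (y s, y (s - r)) = f (statePair R T _ s)
  rw [statePair_apply, key s ⟨by linarith [s.2.1], s.2.2⟩,
    key _ ⟨by simp only [addDeriv]; linarith [s.2.1, hr.2], by
      simp only [addDeriv]; linarith [s.2.2, hr.1]⟩]
  rfl

theorem IsDelaySolution.eq (hf : ContDiff ℝ 1 f) (hr : r ∈ Icc 0 R)
    {φ : SobolevW E (-R) 0 p} {T₁ T₂ : ℝ≥0∞} {x y : ℝ → E} (hx : IsDelaySolution f R r φ T₁ x)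
    (hy : IsDelaySolution f R r φ T₂ y) {t : ℝ} (ht : -R ≤ t) (h₁ : ENNReal.ofReal t < T₁)
    (h₂ : ENNReal.ofReal t < T₂) : x t = y t := by
  rcases le_total t 0 with h0 | h0
  · rw [hx.initial t ⟨ht, h0⟩, hy.initial t ⟨ht, h0⟩]
  · obtain ⟨v, hv, hvx⟩ := hx.exists_solvesDeriv hf hr h₁
    obtain ⟨v', hv', hvy⟩ := hy.exists_solvesDeriv hf hr h₂
    rw [← hvx t ⟨ht, le_rfl⟩, ← hvy t ⟨ht, le_rfl⟩, SolvesDeriv.unique h0 hr hv hv']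

end Solutions

/-! ### Local existence, and the maximal solution -/

section Existence

variable {E : Type*} [NormedAddCommGroup E] [NormedSpace ℝ E] [FiniteDimensional ℝ E]
  {p : ℝ≥0∞} [Fact (1 ≤ p)] {R r : ℝ} {f : E × E → E}

/-- A local solution of `α' = f(α, u(t, α))`, where `u` is continuous in time and `1`-Lipschitz in
space; `u` stands for the delayed state, which for short times is known in advance, or for the
present state if there is no delay. -/
theorem exists_hasDerivWithinAt_of_lipschitz (hf : ContDiff ℝ 1 f) {b : ℝ} (hb : 0 < b)
    {u : ℝ → E → E} (hlip : ∀ t, LipschitzWith 1 (u t))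
    (hcont : ∀ x, ContinuousOn (fun t => u t x) (Icc 0 b)) (x₀ : E) :
    ∃ ε, 0 < ε ∧ ε ≤ b ∧ ∃ α : ℝ → E, α 0 = x₀ ∧
      ∀ t ∈ Icc 0 ε, HasDerivWithinAt α (f (α t, u t (α t))) (Icc 0 ε) t := by
  obtain ⟨K, s, hs, hK⟩ := (hf.contDiffAt (x := (x₀, u 0 x₀))).exists_lipschitzOnWith
  obtain ⟨a, ha, has⟩ := Metric.mem_nhds_iff.1 hs
  set L : ℝ := K * a + ‖f (x₀, u 0 x₀)‖ with hL
  have hL0 : 0 ≤ L := by positivity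
  have h1 : ∀ᶠ t in 𝓝[Icc 0 b] 0, dist (u t x₀) (u 0 x₀) < a / 2 :=
    (hcont x₀ 0 ⟨le_rfl, hb.le⟩).eventually (Metric.ball_mem_nhds _ (by positivity))
  rw [eventually_nhdsWithin_iff] at h1
  obtain ⟨δ, hδ, hδ'⟩ := Metric.eventually_nhds_iff.1 h1
  -- In space `a / 4` suffices: `u t x` may move by `a / 4` with `x` and by `a / 2` with `t`, and so
  -- stays within `a` of `u 0 x₀`. The last bound keeps solutions of speed `≤ L` in that ball.
  set ε := min (min b (δ / 2)) ((a / 4) / (L + 1)) with hε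
  have hε0 : 0 < ε := by positivity
  have hεb : ε ≤ b := (min_le_left _ _).trans (min_le_left _ _)
  have hεδ : ε ≤ δ / 2 := (min_le_left _ _).trans (min_le_right _ _)
  have hmem : ∀ t ∈ Icc 0 ε, ∀ x ∈ Metric.closedBall x₀ (a / 4),
      (x, u t x) ∈ Metric.ball (x₀, u 0 x₀) a := fun t ht x hx => by
    have h2 : dist (u t x₀) (u 0 x₀) < a / 2 := by
      refine hδ' ?_ ⟨ht.1, ht.2.trans hεb⟩
      rw [Real.dist_eq, sub_zero, abs_of_nonneg ht.1]
      linarith [ht.2]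
    have h3 : dist (u t x) (u t x₀) ≤ dist x x₀ := by simpa using (hlip t).dist_le_mul x x₀
    rw [Metric.mem_closedBall] at hx
    rw [Metric.mem_ball, Prod.dist_eq]
    refine max_lt (by linarith) ?_
    linarith [dist_triangle (u t x) (u t x₀) (u 0 x₀)]
  have hPL : IsPicardLindelof (fun t x => f (x, u t x)) (tmin := 0) (tmax := ε)
      ⟨0, le_rfl, hε0.le⟩ x₀ ⟨a / 4, by positivity⟩ 0 ⟨L, hL0⟩ K := by
    refine ⟨fun t ht => ?_, fun x _ => ?_, fun t ht x hx => ?_, ?_⟩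
    · have h4 : LipschitzWith 1 (fun x => (x, u t x)) := by
        simpa using LipschitzWith.id.prodMk (hlip t)
      have h5 := hK.comp (h4.lipschitzOnWith (s := Metric.closedBall x₀ (a / 4)))
        fun x hx => has (hmem t ht x hx)
      rw [mul_one] at h5
      exact h5
    · exact hf.continuous.comp_continuousOn (continuousOn_const.prodMk
        ((hcont x).mono (Icc_subset_Icc_right hεb)))
    · have h6 := hmem t ht x hx
      have h7 := hK.dist_le_mul _ (has h6) _ (has (Metric.mem_ball_self ha))
      rw [dist_eq_norm] at h7
      have h8 : ‖f (x, u t x)‖ ≤ ‖f (x, u t x) - f (x₀, u 0 x₀)‖ + ‖f (x₀, u 0 x₀)‖ := by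
        simpa using norm_add_le (f (x, u t x) - f (x₀, u 0 x₀)) (f (x₀, u 0 x₀))
      have h9 : (K : ℝ) * dist (x, u t x) (x₀, u 0 x₀) ≤ K * a :=
        mul_le_mul_of_nonneg_left (Metric.mem_ball.1 h6).le K.2
      change ‖f (x, u t x)‖ ≤ L
      linarith
    · change L * max (ε - 0) (0 - 0) ≤ a / 4 - 0
      rw [sub_zero, sub_zero, sub_zero, max_eq_left hε0.le]
      calc L * ε ≤ L * ((a / 4) / (L + 1)) := mul_le_mul_of_nonneg_left (min_le_right _ _) hL0
        _ = (L / (L + 1)) * (a / 4) := by ring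
        _ ≤ 1 * (a / 4) := by
          gcongr
          rw [div_le_one (by linarith)]
          linarith
        _ = a / 4 := one_mul _
  obtain ⟨α, hα0, hα⟩ := hPL.exists_eq_forall_mem_Icc_hasDerivWithinAt₀
  exact ⟨ε, hε0, hεb, α, hα0, hα⟩

omit [Fact (1 ≤ p)] in
theorem exists_isDelaySolution (hf : ContDiff ℝ 1 f) (hR : 0 < R) (hr : r ∈ Icc 0 R)
    (φ : SobolevW E (-R) 0 p) : ∃ T x, IsDelaySolution f R r φ T x := by
  have hφ : ContinuousOn (⇑φ) (Icc (-R) 0) := by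
    have h2 := φ.absolutelyContinuous.continuousOn
    rwa [uIcc_of_le (by linarith)] at h2
  obtain ⟨ε, hε, α, hα0, hα⟩ : ∃ ε, 0 < ε ∧ ∃ α : ℝ → E, α 0 = φ 0 ∧ ∀ t ∈ Icc 0 ε,
      HasDerivWithinAt α (f (α t, if t - r ≤ 0 then φ (t - r) else α (t - r))) (Icc 0 ε) t := by
    -- Without delay the equation is an ordinary one; otherwise `t - r ≤ 0` for `t ≤ r`.
    rcases hr.1.eq_or_lt with h0 | h0
    · obtain ⟨ε, hε, -, α, hα0, hα⟩ := exists_hasDerivWithinAt_of_lipschitz hf zero_lt_one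
        (u := fun _ x => x) (fun _ => LipschitzWith.id) (fun _ => continuousOn_const) (φ 0)
      refine ⟨ε, hε, α, hα0, fun t ht => ?_⟩
      convert hα t ht using 3
      rw [← h0, sub_zero]
      split_ifs with h
      · rw [le_antisymm h ht.1, hα0]
      · rfl
    · obtain ⟨ε, hε, hεr, α, hα0, hα⟩ := exists_hasDerivWithinAt_of_lipschitz hf h0
        (u := fun t _ => φ (t - r)) (fun _ => LipschitzWith.const' _)
        (fun _ => hφ.comp (by fun_prop) fun t ht =>
          ⟨by linarith [ht.1, hr.2], by linarith [ht.2]⟩) (φ 0)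
      refine ⟨ε, hε, α, hα0, fun t ht => ?_⟩
      convert hα t ht using 3
      rw [if_pos (by linarith [ht.2])]
  let x : ℝ → E := fun t => if t ≤ 0 then φ t else α t
  have hx : ∀ t, 0 ≤ t → x t = α t := fun t ht => by
    simp only [x]
    split_ifs with h
    · rw [le_antisymm h ht, hα0]
    · rfl
  refine ⟨ENNReal.ofReal ε, x, ENNReal.ofReal_pos.2 hε, fun θ hθ => if_pos hθ.2,
    fun t ht htε => ?_⟩
  have htε' : t < ε := (ENNReal.ofReal_lt_ofReal_iff hε).1 htε
  rw [hx t ht]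
  refine ((hα t ⟨ht, htε'.le⟩).mono_of_mem_nhdsWithin ?_).congr (fun s hs => hx s hs) (hx t ht)
  filter_upwards [self_mem_nhdsWithin, mem_nhdsWithin_of_mem_nhds (Iio_mem_nhds htε')]
    with s hs hs' using ⟨hs, le_of_lt hs'⟩

omit [FiniteDimensional ℝ E] in
theorem IsDelaySolution.congr {φ : ℝ → E} {T : ℝ≥0∞} {x y : ℝ → E} {t : ℝ}
    (hy : IsDelaySolution f R r φ T y) (hr : r ∈ Icc 0 R) (ht : 0 ≤ t) (htT : ENNReal.ofReal t < T)
    (h : ∀ s, -R ≤ s → ENNReal.ofReal s < T → x s = y s) :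
    HasDerivWithinAt x (f (x t, x (t - r))) (Ici 0) t := by
  have hR : 0 ≤ R := hr.1.trans hr.2
  rw [h t (by linarith) htT, h (t - r) (by linarith [hr.2])
    ((ENNReal.ofReal_le_ofReal (by linarith [hr.1])).trans_lt htT)]
  refine (hy.hasDeriv t ht htT).congr_of_eventuallyEq ?_ (h t (by linarith) htT)
  have h1 : ∀ᶠ s in 𝓝[Ici 0] t, ENNReal.ofReal s < T :=
    mem_nhdsWithin_of_mem_nhds (ENNReal.continuous_ofReal.continuousAt.eventually (gt_mem_nhds htT))
  filter_upwards [h1, self_mem_nhdsWithin] with s hs hs'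
  exact h s (by linarith [mem_Ici.1 hs']) hs

/-- The supremum of all existence times is attained: at time `s`, take the value at `s` of any
solution living beyond `s`; by uniqueness the choice does not matter. -/
theorem exists_isMaximalDelaySolution (hf : ContDiff ℝ 1 f) (hR : 0 < R) (hr : r ∈ Icc 0 R)
    (φ : SobolevW E (-R) 0 p) : ∃ T x, IsMaximalDelaySolution f R r φ T x := by
  classical
  set S : Set ℝ≥0∞ := {T | ∃ x, IsDelaySolution f R r φ T x} with hS
  have hex : ∀ t : ℝ, ENNReal.ofReal t < sSup S →
      ∃ T x, IsDelaySolution f R r φ T x ∧ ENNReal.ofReal t < T := fun t ht => by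
    obtain ⟨T, ⟨x, hx⟩, hT⟩ := lt_sSup_iff.1 ht
    exact ⟨T, x, hx, hT⟩
  choose! τ y hy hτ using hex
  have hagree : ∀ (T : ℝ≥0∞) (x : ℝ → E), IsDelaySolution f R r φ T x → ∀ s : ℝ, -R ≤ s →
      ENNReal.ofReal s < T → y s s = x s := fun T x hx s hs hsT =>
    have h1 : ENNReal.ofReal s < sSup S := hsT.trans_le (le_sSup ⟨x, hx⟩)
    (hy s h1).eq hf hr hx hs (hτ s h1) hsT
  obtain ⟨T₀, x₀, h₀⟩ := exists_isDelaySolution hf hR hr φ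
  have hpos : 0 < sSup S := h₀.pos.trans_le (le_sSup ⟨x₀, h₀⟩)
  refine ⟨sSup S, fun s => y s s, ⟨hpos, fun θ hθ => ?_, fun t ht htT => ?_⟩, ?_⟩
  · rw [hagree T₀ x₀ h₀ θ hθ.1 (by rw [ENNReal.ofReal_of_nonpos hθ.2]; exact h₀.pos),
      h₀.initial θ hθ]
  · exact (hy t htT).congr (x := fun s => y s s) hr ht (hτ t htT)
      fun s hs hsT => hagree _ _ (hy t htT) s hs hsT
  · exact fun T' x' hx' hle _ => le_antisymm (le_sSup ⟨x', hx'⟩) hle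

theorem isMaximalDelaySolution_delaySolution (hf : ContDiff ℝ 1 f) (hR : 0 < R)
    (hr : r ∈ Icc 0 R) (φ : SobolevW E (-R) 0 p) :
    IsMaximalDelaySolution f R r φ (delayEscapeTime f R r φ) (delaySolution f R r φ) := by
  obtain ⟨T, x, h⟩ := exists_isMaximalDelaySolution hf hR hr φ
  exact Classical.epsilon_spec
    (p := fun q : ℝ≥0∞ × (ℝ → E) => IsMaximalDelaySolution f R r φ q.1 q.2) ⟨(T, x), h⟩

/-- Every solution is a restriction of the maximal one. -/
theorem IsDelaySolution.le_delayEscapeTime (hf : ContDiff ℝ 1 f) (hR : 0 < R) (hr : r ∈ Icc 0 R)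
    {φ : SobolevW E (-R) 0 p} {T : ℝ≥0∞} {x : ℝ → E} (hx : IsDelaySolution f R r φ T x) :
    T ≤ delayEscapeTime f R r φ ∧ AgreeBefore R T x (delaySolution f R r φ) := by
  have hm := isMaximalDelaySolution_delaySolution hf hR hr φ
  have h1 : T ≤ delayEscapeTime f R r φ := by
    by_contra! hlt
    exact hlt.ne' (hm.maximal T x hx hlt.le fun t ht htT =>
      hx.eq hf hr hm.isSolution ht (htT.trans hlt) htT)
  exact ⟨h1, fun t ht htT => hx.eq hf hr hm.isSolution ht htT (htT.trans_le h1)⟩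

theorem IsMaximalDelaySolution.eq (hf : ContDiff ℝ 1 f) (hR : 0 < R) (hr : r ∈ Icc 0 R)
    {φ : SobolevW E (-R) 0 p} {T : ℝ≥0∞} {x : ℝ → E} (hx : IsMaximalDelaySolution f R r φ T x) :
    T = delayEscapeTime f R r φ ∧ AgreeBefore R T x (delaySolution f R r φ) := by
  obtain ⟨h1, h2⟩ := hx.isSolution.le_delayEscapeTime hf hR hr
  refine ⟨(hx.maximal _ _ (isMaximalDelaySolution_delaySolution hf hR hr φ).isSolution h1
    fun t ht htT => (h2 t ht htT).symm).symm, h2⟩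

end Existence

/-! ### Histories -/

section History

variable {E : Type*} [NormedAddCommGroup E] [NormedSpace ℝ E] [FiniteDimensional ℝ E]
  {p : ℝ≥0∞} [Fact (1 ≤ p)] {R r : ℝ} {f : E × E → E}

/-- The value and the derivative describing the translate `θ ↦ traj R z (t + θ)`. -/
def window (R t : ℝ) (z : E × Lp E p (volume : Measure ℝ)) : E × Lp E p (volume : Measure ℝ) :=
  (traj R z (t - R), shift E p (-t) z.2)

omit [FiniteDimensional ℝ E] in
theorem traj_window (t : ℝ) (z : E × Lp E p (volume : Measure ℝ)) (θ : ℝ) :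
    traj R (window R t z) θ = traj R z (t + θ) := by
  have hi := Lp.intervalIntegrable z.2
  simp only [window]
  rw [traj, traj, integral_shift, traj, add_assoc, sub_neg_eq_add, sub_neg_eq_add,
    show -R + t = t - R by ring, intervalIntegral.integral_add_adjacent_intervals (hi _ _) (hi _ _),
    add_comm θ t]

omit [FiniteDimensional ℝ E] in
theorem continuous_window (hp : p ≠ ∞) :
    Continuous fun q : ℝ × (E × Lp E p (volume : Measure ℝ)) => window R q.1 q.2 := by
  have h1 := (continuous_traj_uncurry (E := E) (p := p) R).comp
    (f := fun q : ℝ × (E × Lp E p (volume : Measure ℝ)) => (q.2, q.1 - R)) (by fun_prop)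
  have h2 := (continuous_shift (E := E) hp).comp
    (f := fun q : ℝ × (E × Lp E p (volume : Measure ℝ)) => (-q.1, q.2.2)) (by fun_prop)
  exact h1.prodMk h2

variable (E R) in
/-- `window R t` as a continuous linear map. -/
def windowCLM (hp : p ≠ ∞) (t : ℝ) :
    (E × Lp E p (volume : Measure ℝ)) →L[ℝ] E × Lp E p (volume : Measure ℝ) where
  toFun := window R t
  map_add' z w := Prod.ext (traj_add R z w _) (map_add (shift E p (-t)) z.2 w.2)
  map_smul' c z := Prod.ext (traj_smul R c z _) (map_smul (shift E p (-t)) c z.2)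
  cont := (continuous_window hp).comp (Continuous.prodMk_right t)

omit [Fact (1 ≤ p)] in
theorem sobolevHistory_eq {x : ℝ → E} {t : ℝ} {φ : SobolevW E (-R) 0 p}
    (h : history R x t = φ.toFun) : sobolevHistory R p x t = φ := by
  have h1 : history R x t ∈ sobolevSubmodule E (-R) 0 p := by
    rw [h]
    exact (show ↥(sobolevSubmodule E (-R) 0 p) from φ).2
  unfold sobolevHistory
  rw [dif_pos h1]
  exact SobolevW.ext h

omit [Fact (1 ≤ p)] in
theorem sobolevHistory_apply {x : ℝ → E} {t : ℝ}
    (h : history R x t ∈ sobolevSubmodule E (-R) 0 p) {θ : ℝ} (hθ : θ ∈ Icc (-R) 0) :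
    sobolevHistory R p x t θ = x (t + θ) := by
  unfold sobolevHistory
  rw [dif_pos h]
  exact zeroExtend_of_mem _ hθ

omit [Fact (1 ≤ p)] in
theorem sobolevHistory_congr {x y : ℝ → E} {t s : ℝ} (h : history R x t = history R y s) :
    sobolevHistory R p x t = sobolevHistory R p y s := by
  by_cases hs : history R y s ∈ sobolevSubmodule E (-R) 0 p
  · let φ : SobolevW E (-R) 0 p := ⟨history R y s, hs⟩
    rw [sobolevHistory_eq (φ := φ) h, sobolevHistory_eq (φ := φ) rfl]
  · unfold sobolevHistory
    rw [dif_neg hs, dif_neg (by rwa [h])]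

theorem history_traj {x : ℝ → E} {z : E × Lp E p (volume : Measure ℝ)} {t : ℝ}
    (h : ∀ θ ∈ Icc (-R) 0, x (t + θ) = traj R z (t + θ)) :
    history R x t = (SobolevW.ofTraj R (window R t z)).toFun := by
  funext θ
  exact (h θ θ.2).trans (traj_window t z θ).symm

/-- Near `(φ₀, r₀)` the maximal solutions exist on a common interval `[0, T)`, and there they are
trajectories of data depending `C^1`-smoothly on `(φ, r)`. -/
theorem exists_contDiffAt_trajectory (hf : ContDiff ℝ 1 f) (hp : p ≠ ∞) (hR : 0 < R) {T : ℝ}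
    (hT : 0 < T) {u₀ : SobolevW E (-R) 0 p × ℝ} (hu₀ : u₀.2 ∈ Icc 0 R)
    (hTu₀ : ENNReal.ofReal T < delayEscapeTime f R u₀.2 u₀.1) :
    ∃ Z : SobolevW E (-R) 0 p × ℝ → E × Lp E p (volume : Measure ℝ), ContDiffAt ℝ 1 Z u₀ ∧
      ∀ᶠ u in 𝓝 u₀, u.2 ∈ Icc 0 R → ENNReal.ofReal T ≤ delayEscapeTime f R u.2 u.1 ∧
        ∀ t, -R ≤ t → t < T → delaySolution f R u.2 u.1 t = traj R (Z u) t := by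
  obtain ⟨v, hv, -⟩ := (isMaximalDelaySolution_delaySolution hf hR hu₀
    u₀.1).isSolution.exists_solvesDeriv hf hu₀ hTu₀
  obtain ⟨S, hS, -, hev⟩ := hv.exists_contDiffAt hp hT.le hu₀
  let Q : SobolevW E (-R) 0 p × ℝ →L[ℝ] ℝ × (E × Lp E p (volume : Measure ℝ)) :=
    (ContinuousLinearMap.snd ℝ _ _).prod
      (SobolevW.toPair E p R ∘L ContinuousLinearMap.fst ℝ _ _)
  have hQS : ContDiffAt ℝ 1 (fun u => S (Q u)) u₀ := hS.comp u₀ Q.contDiff.contDiffAt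
  refine ⟨fun u => (addDeriv (Q u) (S (Q u))).2, ?_, ?_⟩
  · have h1 : ContDiffAt ℝ 1 (fun u => (Q u).2) u₀ := contDiffAt_snd.comp u₀ Q.contDiff.contDiffAt
    exact (contDiffAt_fst.comp u₀ h1).prodMk ((contDiffAt_snd.comp u₀ h1).add hQS)
  · filter_upwards [Q.continuous.continuousAt.eventually hev] with u hu hur
    have h2 := SolvesDeriv.isDelaySolution hR.le hT hu
    obtain ⟨h3, h4⟩ := h2.le_delayEscapeTime hf hR hur
    exact ⟨h3, fun t ht htT => (h4 t ht ((ENNReal.ofReal_lt_ofReal_iff hT).2 htT)).symm⟩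

theorem exists_real_between {t : ℝ≥0} {b : ℝ≥0∞} (h : (t : ℝ≥0∞) < b) :
    ∃ T : ℝ, 0 < T ∧ (t : ℝ) < T ∧ ENNReal.ofReal T < b := by
  obtain ⟨T, hT0, h1, h2⟩ := ENNReal.lt_iff_exists_real_btwn.1 h
  rw [← ENNReal.ofReal_coe_nnreal] at h1
  have h3 : (t : ℝ) < T := (ENNReal.ofReal_lt_ofReal_iff_of_nonneg t.2).1 h1
  exact ⟨T, t.2.trans_lt h3, h3, h2⟩

theorem history_mem_sobolevSubmodule (hf : ContDiff ℝ 1 f) (hp : p ≠ ∞) (hR : 0 < R)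
    (φ : SobolevW E (-R) 0 p) (hr : r ∈ Icc 0 R) {t : ℝ≥0}
    (ht : (t : ℝ≥0∞) < delayEscapeTime f R r φ) :
    history R (delaySolution f R r φ) t ∈ sobolevSubmodule E (-R) 0 p := by
  obtain ⟨T, hT, htT, hTe⟩ := exists_real_between ht
  obtain ⟨Z, -, hZ⟩ := exists_contDiffAt_trajectory hf hp hR hT (u₀ := (φ, r)) hr hTe
  have h1 := (hZ.self_of_nhds hr).2
  rw [history_traj (z := Z (φ, r)) fun θ hθ => h1 _ (by linarith [hθ.1, t.2, NNReal.coe_nonneg t])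
    (by linarith [hθ.2])]
  exact (show ↥(sobolevSubmodule E (-R) 0 p) from SobolevW.ofTraj R (window R t (Z (φ, r)))).2

end History

/-! ### The semiflow -/

section Semiflow

variable {E : Type*} [NormedAddCommGroup E] [NormedSpace ℝ E] [FiniteDimensional ℝ E]
  {p : ℝ≥0∞} [Fact (1 ≤ p)] {R r : ℝ} {f : E × E → E}

/-- Near `(t₀, u₀)` the semiflow is the composition of the translation of trajectories with the
smooth map from data to trajectories. -/
theorem exists_delaySemiflow_eq (hf : ContDiff ℝ 1 f) (hp : p ≠ ∞) (hR : 0 < R) {t₀ : ℝ≥0}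
    {u₀ : SobolevW E (-R) 0 p × ℝ} (hu₀ : u₀.2 ∈ Icc 0 R)
    (ht₀ : (t₀ : ℝ≥0∞) < delayEscapeTime f R u₀.2 u₀.1) :
    ∃ T : ℝ, (t₀ : ℝ) < T ∧
    ∃ Z : SobolevW E (-R) 0 p × ℝ → E × Lp E p (volume : Measure ℝ), ContDiffAt ℝ 1 Z u₀ ∧
      ∀ᶠ u in 𝓝 u₀, u.2 ∈ Icc 0 R → ∀ t : ℝ≥0, (t : ℝ) < T →
        delaySemiflow f R p t u = (SobolevW.ofTrajCLM E p hR.le (window R t (Z u)), u.2) := by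
  obtain ⟨T, hT, htT, hTe⟩ := exists_real_between ht₀
  obtain ⟨Z, hZ, hev⟩ := exists_contDiffAt_trajectory hf hp hR hT hu₀ hTe
  refine ⟨T, htT, Z, hZ, ?_⟩
  filter_upwards [hev] with u hu hur t htT
  refine Prod.ext (sobolevHistory_eq (history_traj fun θ hθ => ?_)) rfl
  exact (hu hur).2 _ (by linarith [hθ.1, NNReal.coe_nonneg t]) (by linarith [hθ.2])

theorem lowerSemicontinuousOn_delayEscapeTime (hf : ContDiff ℝ 1 f) (hp : p ≠ ∞) (hR : 0 < R) :
    LowerSemicontinuousOn (fun u : SobolevW E (-R) 0 p × ℝ => delayEscapeTime f R u.2 u.1)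
      ((univ : Set (SobolevW E (-R) 0 p)) ×ˢ Icc (0 : ℝ) R) := by
  intro u₀ hu₀ y hy
  obtain ⟨T, -, hyT, hTe⟩ := ENNReal.lt_iff_exists_real_btwn.1 hy
  have hT : 0 < T := ENNReal.ofReal_pos.1 (bot_le.trans_lt hyT)
  obtain ⟨Z, -, hev⟩ := exists_contDiffAt_trajectory hf hp hR hT hu₀.2 hTe
  filter_upwards [mem_nhdsWithin_of_mem_nhds hev, self_mem_nhdsWithin] with u hu hur
  exact hyT.trans_le (hu hur.2).1

theorem continuousOn_delaySemiflow (hf : ContDiff ℝ 1 f) (hp : p ≠ ∞) (hR : 0 < R) :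
    ContinuousOn (fun q : ℝ≥0 × (SobolevW E (-R) 0 p × ℝ) => delaySemiflow f R p q.1 q.2)
      (semiflowDomain ((univ : Set (SobolevW E (-R) 0 p)) ×ˢ Icc (0 : ℝ) R)
        (fun u => delayEscapeTime f R u.2 u.1)) := by
  rintro ⟨t₀, u₀⟩ ⟨hu₀, ht₀⟩
  obtain ⟨T, htT, Z, hZ, hev⟩ := exists_delaySemiflow_eq hf hp hR hu₀.2 ht₀
  have h1 : ContinuousAt (fun q : ℝ≥0 × (SobolevW E (-R) 0 p × ℝ) =>
      (SobolevW.ofTrajCLM E p hR.le (window R q.1 (Z q.2)), q.2.2)) (t₀, u₀) := by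
    have h2 : ContinuousAt (fun q : ℝ≥0 × (SobolevW E (-R) 0 p × ℝ) => ((q.1 : ℝ), Z q.2))
        (t₀, u₀) :=
      (NNReal.continuous_coe.comp continuous_fst).continuousAt.prodMk
        (ContinuousAt.comp (g := Z) hZ.continuousAt continuous_snd.continuousAt)
    exact (((SobolevW.ofTrajCLM E p hR.le).continuous.comp
      (continuous_window hp)).continuousAt.comp h2).prodMk
        (continuous_snd.comp continuous_snd).continuousAt
  refine h1.continuousWithinAt.congr_of_eventuallyEq ?_ (hev.self_of_nhds hu₀.2 t₀ htT)
  have h3 : ∀ᶠ q : ℝ≥0 × (SobolevW E (-R) 0 p × ℝ) in 𝓝 (t₀, u₀), (q.1 : ℝ) < T :=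
    (NNReal.continuous_coe.comp continuous_fst).continuousAt.eventually (gt_mem_nhds htT)
  filter_upwards [mem_nhdsWithin_of_mem_nhds (continuous_snd.continuousAt.eventually hev),
    mem_nhdsWithin_of_mem_nhds h3, self_mem_nhdsWithin] with q hq hqT hqd
  exact hq hqd.1.2 q.1 hqT

theorem uniqueDiffOn_univ_prod_Icc (hR : 0 < R) :
    UniqueDiffOn ℝ ((univ : Set (SobolevW E (-R) 0 p)) ×ˢ Icc (0 : ℝ) R) :=
  uniqueDiffOn_univ.prod (uniqueDiffOn_Icc hR)

theorem continuouslyFrechetDifferentiableOn_of_contDiffOn {X Y : Type*} [NormedAddCommGroup X]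
    [NormedSpace ℝ X] [Nontrivial X] [NormedAddCommGroup Y] [NormedSpace ℝ Y] {g : X → Y}
    {U : Set X} (hU : UniqueDiffOn ℝ U) (hg : ContDiffOn ℝ 1 g U) :
    ContinuouslyFrechetDifferentiableOn g U := by
  refine ⟨fun x hx => (hU x hx).accPt, fderivWithin ℝ g U, fun x hx => ?_,
    hg.continuousOn_fderivWithin hU le_rfl⟩
  have h1 := (hg.differentiableOn one_ne_zero x hx).hasFDerivWithinAt
  exact ⟨h1, fun A hA => (hU x hx).eq hA h1⟩

theorem continuouslyFrechetDifferentiableOn_delaySemiflow (hf : ContDiff ℝ 1 f) (hp : p ≠ ∞)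
    (hR : 0 < R) (t : ℝ≥0) :
    ContinuouslyFrechetDifferentiableOn (delaySemiflow f R p t)
      {u : SobolevW E (-R) 0 p × ℝ | u ∈ (univ : Set (SobolevW E (-R) 0 p)) ×ˢ Icc (0 : ℝ) R ∧
        (t : ℝ≥0∞) < delayEscapeTime f R u.2 u.1} := by
  apply continuouslyFrechetDifferentiableOn_of_contDiffOn
  · rintro u₀ ⟨hu₀, ht⟩
    refine (uniqueDiffOn_univ_prod_Icc hR u₀ hu₀).mono_nhds ?_
    rw [nhdsWithin_le_iff]
    filter_upwards [self_mem_nhdsWithin,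
      lowerSemicontinuousOn_delayEscapeTime hf hp hR u₀ hu₀ t ht] with u h1 h2 using ⟨h1, h2⟩
  · rintro u₀ ⟨hu₀, ht⟩
    obtain ⟨T, htT, Z, hZ, hev⟩ := exists_delaySemiflow_eq hf hp hR hu₀.2 ht
    have h1 : ContDiffAt ℝ 1 (fun u : SobolevW E (-R) 0 p × ℝ =>
        (SobolevW.ofTrajCLM E p hR.le (windowCLM E R hp t (Z u)), u.2)) u₀ :=
      ((SobolevW.ofTrajCLM E p hR.le ∘L windowCLM E R hp t).contDiff.contDiffAt.comp u₀
        hZ).prodMk contDiffAt_snd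
    refine h1.contDiffWithinAt.congr_of_eventuallyEq ?_ (hev.self_of_nhds hu₀.2 t htT)
    filter_upwards [mem_nhdsWithin_of_mem_nhds hev, self_mem_nhdsWithin] with u hu hud
    exact hu hud.1.2 t htT

omit [FiniteDimensional ℝ E] in
/-- A solution followed by a solution starting from its history at time `t` is a solution. -/
theorem IsDelaySolution.glue {φ ψ : ℝ → E} {T T' : ℝ≥0∞} {x y : ℝ → E} (hr : r ∈ Icc 0 R)
    (hx : IsDelaySolution f R r φ T x) {t : ℝ≥0} (ht : (t : ℝ≥0∞) < T)
    (hy : IsDelaySolution f R r ψ T' y) (hψ : ∀ θ ∈ Icc (-R) 0, ψ θ = x (t + θ)) :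
    ∃ z : ℝ → E, IsDelaySolution f R r φ (t + T') z ∧ ∀ s : ℝ, t - R ≤ s → z s = y (s - t) := by
  have hR : 0 ≤ R := hr.1.trans hr.2
  have ht0 : (0 : ℝ) ≤ t := t.2
  let z : ℝ → E := fun s => if s ≤ t then x s else y (s - t)
  have hzx : ∀ s : ℝ, s ≤ t → z s = x s := fun s hs => if_pos hs
  have hzy : ∀ s : ℝ, t - R ≤ s → z s = y (s - t) := fun s hs => by
    rcases le_or_gt s t with h | h
    · have h1 : s - t ∈ Icc (-R) 0 := ⟨by linarith, by linarith⟩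
      rw [hzx s h, hy.initial _ h1, hψ _ h1, add_sub_cancel]
    · exact if_neg (not_le.2 h)
  have hleft : ∀ τ : ℝ, 0 ≤ τ → τ ≤ t →
      HasDerivWithinAt z (f (z τ, z (τ - r))) (Icc 0 (t : ℝ)) τ := fun τ hτ hτt => by
    rw [hzx τ hτt, hzx (τ - r) (by linarith [hr.1])]
    refine ((hx.hasDeriv τ hτ ?_).mono Icc_subset_Ici_self).congr (fun s hs => hzx s hs.2)
      (hzx τ hτt)
    refine (ENNReal.ofReal_le_ofReal hτt).trans_lt ?_
    rwa [ENNReal.ofReal_coe_nnreal]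
  have hright : ∀ τ : ℝ, t ≤ τ → ENNReal.ofReal τ < t + T' →
      HasDerivWithinAt z (f (z τ, z (τ - r))) (Ici (t : ℝ)) τ := fun τ hτ hτT => by
    have h1 : ENNReal.ofReal (τ - t) < T' := by
      have h2 : ENNReal.ofReal τ = t + ENNReal.ofReal (τ - t) := by
        rw [← ENNReal.ofReal_coe_nnreal, ← ENNReal.ofReal_add ht0 (by linarith), add_sub_cancel]
      rw [h2] at hτT
      exact lt_of_add_lt_add_left hτT
    have h3 := hy.hasDeriv (τ - t) (by linarith) h1
    rw [hzy τ (by linarith), hzy (τ - r) (by linarith [hr.2]), sub_right_comm]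
    have h4 : HasDerivWithinAt (fun s => y (s - t)) (f (y (τ - t), y (τ - t - r)))
        (Ici (t : ℝ)) τ := by
      have h5 := HasDerivWithinAt.scomp (t' := Ici 0) (h := fun s : ℝ => s - t) τ h3
        ((hasDerivWithinAt_id τ (Ici (t : ℝ))).sub_const (t : ℝ))
        (fun s hs => mem_Ici.2 (sub_nonneg.2 (mem_Ici.1 hs)))
      rwa [one_smul] at h5
    exact h4.congr (fun s hs => hzy s (by linarith [mem_Ici.1 hs])) (hzy τ (by linarith))
  refine ⟨z, ⟨hy.pos.trans_le le_add_self, fun θ hθ => ?_, fun τ hτ hτT => ?_⟩, hzy⟩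
  · rw [hzx θ (hθ.2.trans ht0), hx.initial θ hθ]
  · rcases lt_trichotomy τ t with h | h | h
    · refine (hleft τ hτ h.le).mono_of_mem_nhdsWithin ?_
      filter_upwards [self_mem_nhdsWithin, mem_nhdsWithin_of_mem_nhds (Iio_mem_nhds h)]
        with s hs hs' using ⟨hs, le_of_lt hs'⟩
    · refine ((hleft τ hτ h.le).union (hright τ h.ge hτT)).mono fun s hs => ?_
      exact (le_total s t).imp (fun h' => ⟨hs, h'⟩) id
    · refine (hright τ h.le hτT).mono_of_mem_nhdsWithin ?_
      exact mem_nhdsWithin_of_mem_nhds (Ici_mem_nhds h)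

theorem isMaximalSemiflow_delaySemiflow (hf : ContDiff ℝ 1 f) (hp : p ≠ ∞) (hR : 0 < R) :
    IsMaximalSemiflow ((univ : Set (SobolevW E (-R) 0 p)) ×ˢ Icc (0 : ℝ) R)
      (delaySemiflow f R p) (fun u => delayEscapeTime f R u.2 u.1) where
  escapeTime_pos u hu := (isMaximalDelaySolution_delaySolution hf hR hu.2 u.1).isSolution.pos
  mapsTo t u hu := ⟨mem_univ _, hu.1.2⟩
  map_zero u hu := by
    refine Prod.ext (sobolevHistory_eq (funext fun θ => ?_)) rfl
    have h1 := (isMaximalDelaySolution_delaySolution hf hR hu.2 u.1).isSolution.initial θ θ.2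
    rw [history, NNReal.coe_zero, zero_add, h1]
    exact zeroExtend_of_mem _ θ.2
  map_add t s u hu hs := by
    have hm := (isMaximalDelaySolution_delaySolution hf hR hu.1.2 u.1).isSolution
    have hm' := (isMaximalDelaySolution_delaySolution hf hR hu.1.2
      (delaySemiflow f R p t u).1).isSolution
    have hmem := history_mem_sobolevSubmodule hf hp hR u.1 hu.1.2 hu.2
    obtain ⟨z, hz, hzy⟩ := hm.glue hu.1.2 hu.2 hm' fun θ hθ => sobolevHistory_apply hmem hθ
    obtain ⟨h1, h2⟩ := hz.le_delayEscapeTime hf hR hu.1.2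
    have hlt : ((t + s : ℝ≥0) : ℝ≥0∞) <
        t + delayEscapeTime f R u.2 (delaySemiflow f R p t u).1 := by
      rw [ENNReal.coe_add]
      exact (ENNReal.add_lt_add_iff_left ENNReal.coe_ne_top).2 hs.2
    refine ⟨⟨hu.1, hlt.trans_le h1⟩, Prod.ext (sobolevHistory_congr (funext fun θ => ?_)) rfl⟩
    have ht0 := NNReal.coe_nonneg t
    have hs0 := NNReal.coe_nonneg s
    change delaySolution f R u.2 u.1 ((t + s : ℝ≥0) + θ) =
      delaySolution f R u.2 (delaySemiflow f R p t u).1 (s + θ)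
    rw [NNReal.coe_add, ← h2 _ (by linarith [θ.2.1]), hzy _ (by linarith [θ.2.1])]
    · congr 1
      ring
    · refine lt_of_le_of_lt ?_ hlt
      rw [← ENNReal.ofReal_coe_nnreal, NNReal.coe_add]
      exact ENNReal.ofReal_le_ofReal (by linarith [θ.2.2])

end Semiflow

end

theorem mainTheorem2 {E : Type*} [NormedAddCommGroup E] [NormedSpace ℝ E] [FiniteDimensional ℝ E]
    (R : ℝ) (hR : 0 < R) (p : ℝ≥0∞) [Fact (1 ≤ p)] (hp : p ≠ ∞)
    (f : E × E → E) (hf : ContDiff ℝ 1 f) :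
    -- the initial value problem has a unique maximal solution, on `[-R, T_{φ,r})`
    (∀ (φ : SobolevW E (-R) 0 p), ∀ r ∈ Icc (0 : ℝ) R,
      IsMaximalDelaySolution f R r φ (delayEscapeTime f R r φ) (delaySolution f R r φ) ∧
      ∀ (T : ℝ≥0∞) (x : ℝ → E), IsMaximalDelaySolution f R r φ T x →
        T = delayEscapeTime f R r φ ∧ AgreeBefore R T x (delaySolution f R r φ)) ∧
    -- its histories belong to the Sobolev type space
    (∀ (φ : SobolevW E (-R) 0 p), ∀ r ∈ Icc (0 : ℝ) R, ∀ t : ℝ≥0,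
      (t : ℝ≥0∞) < delayEscapeTime f R r φ →
        history R (delaySolution f R r φ) t ∈ sobolevSubmodule E (-R) 0 p) ∧
    -- `Φ` is a `C^1`-maximal semiflow in `𝒲^{1,p}([-R, 0], E) × [0, R]`
    IsC1MaximalSemiflow ((univ : Set (SobolevW E (-R) 0 p)) ×ˢ Icc (0 : ℝ) R)
      (delaySemiflow f R p) (fun q => delayEscapeTime f R q.2 q.1) := by
  refine ⟨fun φ r hr => ⟨isMaximalDelaySolution_delaySolution hf hR hr φ,
    fun T x hx => hx.eq hf hR hr⟩,
    fun φ r hr t ht => history_mem_sobolevSubmodule hf hp hR φ hr ht, ?_⟩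
  exact
    { isMaximalSemiflow_delaySemiflow hf hp hR with
      continuousOn := continuousOn_delaySemiflow hf hp hR
      lowerSemicontinuousOn := lowerSemicontinuousOn_delayEscapeTime hf hp hR
      accPt := fun u hu => (uniqueDiffOn_univ_prod_Icc hR u hu).accPt
      contFrechet := continuouslyFrechetDifferentiableOn_delaySemiflow hf hp hR }
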